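/- Consider the convex quadratically constrained quadratic program \[ \min_{x\in\mathcal X}\{f(x):\ Ax=b,\ g_i(x)\le 0,\ i=1,\dots,m\},\qquad f(x)=\tfrac12x^\top Q_0x+q_0^\top x+r_0,\quad g_i(x)=\tfrac12x^\top Q_ix+q_i^\top x+r_i, \] where $Q_0,\dots,Q_m\in\mathbb R^{n\times n}$ are symmetric positive semidefinite, $A\in\mathbb R^{p\times n}$, $b\in\mathbb R^p$, and $\mathcal X\subseteq\mathbb R^n$ is a nonempty polyhedral set. Write $g=(g_1,\dots,g_m)$, $\mathcal Y=\mathbb R^p\times\mathbb R^m_+$, \[ \Phi(x,v,\lambda)=f(x)+\langle v,Ax-b\rangle+\langle\lambda,g(x)\rangle,\qquad \mathcal L(x,y)=\iota_{\mathcal X}(x)+\Phi(x,y)-\iota_{\mathcal Y}(y)\quad (y=(v,\lambda)), \] where $\iota_S$ is $0$ on $S$ and $+\infty$ off $S$. Let $\mathcal Z^\star\subseteq\mathcal X\times\mathcal Y$ be the set of saddle points of $\min_x\max_y\mathcal L(x,y)$, and for $z\in\mathcal X\times\mathcal Y$ let $\mathcal F(z)=\partial_x\mathcal L(z)\times\partial_y(-\mathcal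 L)(z)$ (convex subdifferentials). Let $x^\star$ be an optimal solution, $I(x^\star)=\{i: g_i(x^\star)=0\}$, and let $\mathcal T_{\mathcal X}(x^\star)$, $\mathcal N_{\mathcal X}(x^\star)$ be the tangent and normal cones of $\mathcal X$ at $x^\star$. Put \[ \mathcal M(x^\star)=\{(v,\lambda)\in\mathbb R^p\times\mathbb R^m_+:\ -\nabla_x\Phi(x^\star,v,\lambda)\in\mathcal N_{\mathcal X}(x^\star),\ \langle\lambda,g(x^\star)\rangle=0\}, \] \[ \mathcal C(x^\star)=\{d\in\mathcal T_{\mathcal X}(x^\star):\ Ad=0,\ (Q_0x^\star+q_0)^\top d=0,\ (Q_ix^\star+q_i)^\top d\le 0\ \ \forall i\in I(x^\star)\}, \] let $\mathcal C(x^\star)^*=\{u:\langle u,d\rangle\ge0\ \ \forall d\in\mathcal C(x^\star)\}$, and $Q(\lambda)=Q_0+\sum_{i=1}^m\lambda_iQ_i$. Assume that MFCQ holds at $x^\star$ relative to $\mathcal X$: (i) $A^\top v+s=0$ with $v\in\mathbb R^p$, $s\in\mathcal N_{\mathcal X}(x^\star)$ implies $v=0$ and $s=0$; (ii) there is $d\in\mathcal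 T_{\mathcal X}(x^\star)$ with $Ad=0$ and $(Q_ix^\star+q_i)^\top d<0$ for all $i\in I(x^\star)$. Assume also that for every $(v,\lambda)\in\mathcal M(x^\star)$ the system \[ d\in\mathcal C(x^\star),\qquad Q(\lambda)d\in\mathcal C(x^\star)^*,\qquad d^\top Q(\lambda)d=0 \] has only the solution $d=0$. Then $\mathcal M(x^\star)$ and $\mathcal Z^\star$ are nonempty, and there exist constants $c>0$ and $\varepsilon>0$ such that for all $z=(x,v,\lambda)\in\mathcal X\times\mathbb R^p\times\mathbb R^m_+$ with $\|x-x^\star\|+\operatorname{dist}((v,\lambda),\mathcal M(x^\star))\le\varepsilon$, the set $\mathcal F(z)$ is nonempty and \[ \operatorname{dist}(z,\mathcal Z^\star)\le c\cdot\operatorname{dist}(0,\mathcal F(z)). \] All norms and distances are Euclidean. -/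

import Mathlib

open Matrix
open scoped NNReal

noncomputable section

/-! ### Convex-analytic notions -/

section ConvexAnalysis

variable {E : Type*} [NormedAddCommGroup E] [InnerProductSpace ℝ E]

/-- A polyhedral set: the solution set of finitely many (non-strict) linear inequalities. -/
def IsPolyhedralSet (X : Set E) : Prop :=
  ∃ (k : ℕ) (a : Fin k → E) (c : Fin k → ℝ), X = {x | ∀ i, inner ℝ (a i) x ≤ c i}

/-- The normal cone `N_C(x) = {d | ⟨d, x' - x⟩ ≤ 0 for all x' ∈ C}`, for `x ∈ C`. -/
def normalConeAt (C : Set E) (x : E) : Set E :=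
  {d | ∀ x' ∈ C, inner ℝ d (x' - x) ≤ 0}

/-- The (Bouligand) tangent cone `T_C(x)`: limits of `c k • d k` with real scalars `c k ≥ 0`,
`x + d k ∈ C` and `d k → 0`. -/
def bouligandCone (C : Set E) (x : E) : Set E :=
  tangentConeAt ℝ≥0 C x

/-- The dual cone `S^* = {y | ⟨y, x⟩ ≥ 0 for all x ∈ S}`. -/
def dualCone (S : Set E) : Set E :=
  {y | ∀ x ∈ S, 0 ≤ inner ℝ y x}

/-- The subdifferential of an extended-real-valued function. -/
def subdifferential (φ : E → EReal) (x : E) : Set E :=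
  {s | ∀ x', φ x + ((inner ℝ s (x' - x) : ℝ) : EReal) ≤ φ x'}

open Classical in
/-- The indicator function of a set, with values `0` on the set and `+∞` off it. -/
def indicatorFun (C : Set E) (x : E) : EReal :=
  if x ∈ C then 0 else ⊤

end ConvexAnalysis

/-! ### Quadratically constrained quadratic programs -/

/-- The dual space `ℝ^p × ℝ^m` of pairs `y = (v, λ)`, with the Euclidean norm. -/
abbrev DualSpace (p m : ℕ) : Type :=
  WithLp 2 (EuclideanSpace ℝ (Fin p) × EuclideanSpace ℝ (Fin m))

/-- The primal-dual space `ℝ^n × (ℝ^p × ℝ^m)` of `z = (x, (v, λ))`, with the Euclidean norm. -/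
abbrev PDSpace (n p m : ℕ) : Type :=
  WithLp 2 (EuclideanSpace ℝ (Fin n) × DualSpace p m)

/-- The data of the problem
`min {f x : x ∈ X, A x = b, g_i x ≤ 0 for all i}` with
`f x = 1/2 xᵀ Q₀ x + q₀ᵀ x + r₀` and `g_i x = 1/2 xᵀ Q_i x + q_iᵀ x + r_i`. -/
structure QCQP (n p m : ℕ) where
  X : Set (EuclideanSpace ℝ (Fin n))
  Q₀ : Matrix (Fin n) (Fin n) ℝ
  q₀ : EuclideanSpace ℝ (Fin n)
  r₀ : ℝ
  Q : Fin m → Matrix (Fin n) (Fin n) ℝ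
  q : Fin m → EuclideanSpace ℝ (Fin n)
  r : Fin m → ℝ
  A : Matrix (Fin p) (Fin n) ℝ
  b : EuclideanSpace ℝ (Fin p)

namespace QCQP

variable {n p m : ℕ} (P : QCQP n p m)

/-- The objective function. -/
def f (x : EuclideanSpace ℝ (Fin n)) : ℝ :=
  1 / 2 * inner ℝ x (toEuclideanLin P.Q₀ x) + inner ℝ P.q₀ x + P.r₀

/-- The constraint map `g = (g_1, …, g_m)`. -/
def g (x : EuclideanSpace ℝ (Fin n)) : EuclideanSpace ℝ (Fin m) :=
  WithLp.toLp 2 fun i =>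
    1 / 2 * inner ℝ x (toEuclideanLin (P.Q i) x) + inner ℝ (P.q i) x + P.r i

/-- The feasible set. -/
def feasible : Set (EuclideanSpace ℝ (Fin n)) :=
  {x | x ∈ P.X ∧ toEuclideanLin P.A x = P.b ∧ ∀ i, P.g x i ≤ 0}

/-- `x` is an optimal solution. -/
def IsOptimal (x : EuclideanSpace ℝ (Fin n)) : Prop :=
  x ∈ P.feasible ∧ ∀ x' ∈ P.feasible, P.f x ≤ P.f x'

/-- The coupling function `Φ(x, (v, λ)) = f x + ⟨v, A x - b⟩ + ⟨λ, g x⟩`. -/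
def coupling (x : EuclideanSpace ℝ (Fin n)) (y : DualSpace p m) : ℝ :=
  P.f x + inner ℝ y.fst (toEuclideanLin P.A x - P.b) + inner ℝ y.snd (P.g x)

/-- The dual domain `Y = ℝ^p × ℝ^m_+`. -/
def dualDomain (p m : ℕ) : Set (DualSpace p m) :=
  {y | ∀ i, 0 ≤ y.snd i}

/-- The Lagrangian `L(x, y) = ι_X(x) + Φ(x, y) - ι_Y(y)` of the min-max formulation. -/
def lagrangian (x : EuclideanSpace ℝ (Fin n)) (y : DualSpace p m) : EReal :=
  indicatorFun P.X x + (P.coupling x y : EReal) - indicatorFun (dualDomain p m) y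

/-- The domain `Z = X × Y`. -/
def domain : Set (PDSpace n p m) :=
  {z | z.fst ∈ P.X ∧ z.snd ∈ dualDomain p m}

/-- The set `Z^* ⊆ Z` of saddle points of the Lagrangian. -/
def saddleSet : Set (PDSpace n p m) :=
  {z | z ∈ P.domain ∧
    (∀ y, P.lagrangian z.fst y ≤ P.lagrangian z.fst z.snd) ∧
    (∀ x, P.lagrangian z.fst z.snd ≤ P.lagrangian x z.snd)}

/-- The set-valued KKT map `F(z) = ∂_x L(z) × ∂_y (-L)(z)`, for `z ∈ Z`. -/
def kktMap (z : PDSpace n p m) : Set (PDSpace n p m) :=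
  {w | w.fst ∈ subdifferential (fun x => P.lagrangian x z.snd) z.fst ∧
    w.snd ∈ subdifferential (fun y => -P.lagrangian z.fst y) z.snd}

/-- The multiplier set `M(x) = {(v, λ) ∈ Y : -∇_x Φ(x, v, λ) ∈ N_X(x), ⟨λ, g x⟩ = 0}`. -/
def multipliers (x : EuclideanSpace ℝ (Fin n)) : Set (DualSpace p m) :=
  {y | y ∈ dualDomain p m ∧
    -gradient (fun x' => P.coupling x' y) x ∈ normalConeAt P.X x ∧
    inner ℝ y.snd (P.g x) = 0}

/-- MFCQ relative to `X` at the feasible point `x`. -/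
def MFCQ (x : EuclideanSpace ℝ (Fin n)) : Prop :=
  (∀ (v : EuclideanSpace ℝ (Fin p)), ∀ s ∈ normalConeAt P.X x,
      toEuclideanLin P.Aᵀ v + s = 0 → v = 0 ∧ s = 0) ∧
  ∃ d ∈ bouligandCone P.X x, toEuclideanLin P.A d = 0 ∧
    ∀ i, P.g x i = 0 → inner ℝ (toEuclideanLin (P.Q i) x + P.q i) d < 0

/-- The critical cone at the feasible point `x`. -/
def criticalCone (x : EuclideanSpace ℝ (Fin n)) : Set (EuclideanSpace ℝ (Fin n)) :=
  {d | d ∈ bouligandCone P.X x ∧ toEuclideanLin P.A d = 0 ∧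
    inner ℝ (toEuclideanLin P.Q₀ x + P.q₀) d = 0 ∧
    ∀ i, P.g x i = 0 → inner ℝ (toEuclideanLin (P.Q i) x + P.q i) d ≤ 0}

/-- `Q(λ) = Q₀ + ∑ i, λ_i Q_i`. -/
def lagrangianHessian (l : EuclideanSpace ℝ (Fin m)) : Matrix (Fin n) (Fin n) ℝ :=
  P.Q₀ + ∑ i, l i • P.Q i

end QCQP

end

/-! For every `w` in the KKT map at `z = (x, y)` near `{xs} × M`, where `M` is the multiplier set at
`xs`, the proof shows `‖x - xs‖ + dist(y, M) ≤ C‖w‖`. Convexity makes each point of `{xs} × M` a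
saddle point, so the left side dominates the distance to the saddle set, and passing to the infimum
over `w` gives the claim. MFCQ makes `M` nonempty (Farkas' lemma applied to the linearized problem)
and bounded.

The dual error is polyhedral. With `xs` fixed, `M` is cut out by a linear system in the multipliers
and the coefficients of the normal vector. Near `xs` every inactive constraint stays inactive, so
the coefficients at `z` satisfy all sign and vanishing conditions exactly and violate only the
stationarity equation, by `O(‖w‖ + ‖x - xs‖)`. Hoffman's bound then gives `dist(y, M) = O(‖w‖ + ‖x -
xs‖)` (`exists_multiplier_near`).

The primal error is handled by contradiction (`exists_primal_error_bound`). Suppose `‖w_j‖ = o(t_j)`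
with `t_j = ‖x_j - xs‖ → 0`. The normalized displacements subconverge to a unit vector `e`, which is
critical (`mem_criticalCone_of_tendsto`), and the `y_j` subconverge to some `y ∈ M`. Saddle
inequalities bound the curvature of the Lagrangian along `x_j - xs` by `‖w_j‖ (t_j + ‖y_j - y'‖)`
for any `y' ∈ M`. Choosing `y'` by the dual estimate makes this `o(t_j²)`, so `eᵀ Q(λ) e = 0`. As
`Q(λ)` is positive semidefinite, `Q(λ) e = 0`; the dual-cone requirement is then automatic and the
second-order hypothesis forces `e = 0`, a contradiction. -/

/-! ### Finitely generated cones -/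

section FinitelyGeneratedCone

open Finset Filter Topology

/-- **Conic Carathéodory theorem**: a conic combination can be supported on a linearly
independent subfamily. -/
theorem exists_conic_combination_linearIndepOn {ι E : Type*} [Fintype ι] [AddCommGroup E]
    [Module ℝ E] (a : ι → E) (μ : ι → ℝ) (hμ : ∀ i, 0 ≤ μ i) :
    ∃ ν : ι → ℝ, (∀ i, 0 ≤ ν i) ∧ (∀ i, μ i = 0 → ν i = 0) ∧
      ∑ i, ν i • a i = ∑ i, μ i • a i ∧ LinearIndepOn ℝ a {i | ν i ≠ 0} := by
  classical
  induction hN : #{i | μ i ≠ 0} using Nat.strong_induction_on generalizing μ with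
  | _ N ih =>
  by_cases hli : LinearIndepOn ℝ a {i | μ i ≠ 0}
  · exact ⟨μ, hμ, fun _ h => h, rfl, hli⟩
  -- A dependence relation may be negated, so it can be assumed to have a positive coefficient.
  have hdep : ∃ η : ι → ℝ, (∀ i, μ i = 0 → η i = 0) ∧ ∑ i, η i • a i = 0 ∧ ∃ i, 0 < η i := by
    have hset : {i | μ i ≠ 0} = ((({i | μ i ≠ 0} : Finset ι)) : Set ι) := by ext; simp
    rw [hset, linearIndepOn_finset_iff] at hli
    push Not at hli
    obtain ⟨η, h0, j, hj, hne⟩ := hli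
    have key : ∀ θ : ι → ℝ, ∑ i ∈ {i | μ i ≠ 0}, θ i • a i = 0 → 0 < θ j →
        ∃ η : ι → ℝ, (∀ i, μ i = 0 → η i = 0) ∧ ∑ i, η i • a i = 0 ∧ ∃ i, 0 < η i := by
      intro θ hθ hpos
      refine ⟨fun i => if μ i ≠ 0 then θ i else 0, fun i hi => by simp [hi], ?_, j, ?_⟩
      · rw [← hθ, Finset.sum_filter]
        exact Finset.sum_congr rfl fun i _ => by split_ifs <;> simp_all
      · have : μ j ≠ 0 := by simpa using hj
        simpa [this] using hpos
    rcases lt_or_gt_of_ne hne with h | h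
    · exact key (fun i => -η i) (by simp [h0]) (by simpa using h)
    · exact key η h0 h
  obtain ⟨η, hη0, hηs, j, hj⟩ := hdep
  -- Ratio test: subtracting `t • η` with the smallest ratio kills the coefficient at `i₀` and keeps
  -- all others nonnegative, so the support shrinks.
  obtain ⟨i₀, hi₀, hmin⟩ := Finset.exists_min_image ({i | 0 < η i} : Finset ι)
    (fun i => μ i / η i) ⟨j, by simpa using hj⟩
  have hi₀' : 0 < η i₀ := by simpa using hi₀
  set t := μ i₀ / η i₀ with ht
  have ht0 : 0 ≤ t := div_nonneg (hμ _) hi₀'.le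
  have hν : ∀ i, 0 ≤ μ i - t * η i := by
    intro i
    rcases lt_or_ge 0 (η i) with h | h
    · have := hmin i (by simpa using h)
      rw [le_div_iff₀ h] at this
      linarith
    · have := mul_nonneg ht0 (neg_nonneg.2 h)
      linarith [hμ i]
  have hsupp : ∀ i, μ i = 0 → μ i - t * η i = 0 := fun i hi => by simp [hi, hη0 i hi]
  obtain ⟨ν, h1, h2, h3, h4⟩ := ih _ (by
    rw [← hN]
    apply Finset.card_lt_card
    refine (Finset.ssubset_iff_of_subset ?_).2 ⟨i₀, ?_, ?_⟩
    · intro i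
      simp only [mem_filter, mem_univ, true_and]
      exact fun h h' => h (hsupp i h')
    · simp only [mem_filter, mem_univ, true_and]
      exact fun h => hi₀'.ne' (hη0 _ h)
    · simp [ht, div_mul_cancel₀ _ hi₀'.ne']) (fun i => μ i - t * η i) hν rfl
  refine ⟨ν, h1, fun i hi => h2 i (hsupp i hi), ?_, h4⟩
  rw [h3]
  simp only [sub_smul, mul_smul, Finset.sum_sub_distrib, ← Finset.smul_sum, hηs, smul_zero,
    sub_zero]

variable {ι E : Type*} [Fintype ι] [NormedAddCommGroup E]

/-- An injective linear map on a finite-dimensional space is bounded below. -/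
theorem LinearIndepOn.exists_coeff_le [NormedSpace ℝ E] {a : ι → E} {J : Set ι}
    (h : LinearIndepOn ℝ a J) :
    ∃ C : ℝ, 0 ≤ C ∧ ∀ ν : ι → ℝ, (∀ i, i ∉ J → ν i = 0) → ∀ i, ν i ≤ C * ‖∑ i, ν i • a i‖ := by
  classical
  have hinj : LinearMap.ker (Fintype.linearCombination ℝ (fun j : J => a j)) = ⊥ := by
    refine LinearMap.ker_eq_bot'.2 fun v hv => funext fun j => ?_
    exact Fintype.linearIndependent_iff.1 h v hv j
  obtain ⟨K, -, hK⟩ := LinearMap.exists_antilipschitzWith _ hinj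
  refine ⟨K, K.2, fun ν hν i => ?_⟩
  have hsum : Fintype.linearCombination ℝ (fun j : J => a j) (fun j => ν j) = ∑ i, ν i • a i := by
    rw [Fintype.linearCombination_apply]
    exact (Finset.sum_congr_set J _ _ (fun _ _ => rfl) (fun j hj => by simp [hν j hj])).symm
  by_cases hi : i ∈ J
  · have h1 := hK.le_mul_dist (fun j : J => ν j) 0
    rw [map_zero, dist_zero_right, dist_zero_right, hsum] at h1
    have h2 := norm_le_pi_norm (fun j : J => ν j) ⟨i, hi⟩
    exact (le_abs_self _).trans (h2.trans h1)
  · rw [hν i hi]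
    exact mul_nonneg K.2 (norm_nonneg _)

/-- Conic combinations of a finite family can be represented with controlled coefficients. -/
theorem exists_bounded_conic_combination [NormedSpace ℝ E] (a : ι → E) :
    ∃ C : ℝ, 0 ≤ C ∧ ∀ μ : ι → ℝ, (∀ i, 0 ≤ μ i) → ∃ ν : ι → ℝ, (∀ i, 0 ≤ ν i) ∧
      (∀ i, μ i = 0 → ν i = 0) ∧ ∑ i, ν i • a i = ∑ i, μ i • a i ∧
      ∀ i, ν i ≤ C * ‖∑ i, μ i • a i‖ := by
  classical
  -- There are finitely many possible supports, so the sum of their constants serves uniformly.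
  have h : ∀ J : Finset ι, ∃ C : ℝ, 0 ≤ C ∧ (LinearIndepOn ℝ a (J : Set ι) →
      ∀ ν : ι → ℝ, (∀ i, i ∉ J → ν i = 0) → ∀ i, ν i ≤ C * ‖∑ i, ν i • a i‖) := by
    intro J
    by_cases hJ : LinearIndepOn ℝ a (J : Set ι)
    · obtain ⟨C, h0, hC⟩ := hJ.exists_coeff_le
      exact ⟨C, h0, fun _ => hC⟩
    · exact ⟨0, le_rfl, fun h => absurd h hJ⟩
  choose C h0 hC using h
  refine ⟨∑ J, C J, Finset.sum_nonneg fun J _ => h0 J, fun μ hμ => ?_⟩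
  obtain ⟨ν, h1, h2, h3, h4⟩ := exists_conic_combination_linearIndepOn a μ hμ
  refine ⟨ν, h1, h2, h3, fun i => ?_⟩
  have hset : {i | ν i ≠ 0} = ((({i | ν i ≠ 0} : Finset ι)) : Set ι) := by ext; simp
  rw [hset] at h4
  rw [← h3]
  refine (hC _ h4 ν (fun i hi => by simpa using hi) i).trans ?_
  gcongr
  exact Finset.single_le_sum (fun J _ => h0 J) (Finset.mem_univ _)

/-- With controlled coefficients, the points of the cone near `w` lie in the image of a fixed
compact box. -/
theorem isClosed_setOf_conic_combination [NormedSpace ℝ E] (a : ι → E) :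
    IsClosed {w | ∃ μ : ι → ℝ, (∀ i, 0 ≤ μ i) ∧ w = ∑ i, μ i • a i} := by
  obtain ⟨C, hC0, hC⟩ := exists_bounded_conic_combination a
  refine isClosed_of_closure_subset fun w hw => ?_
  set K : Set E := (fun μ : ι → ℝ => ∑ i, μ i • a i) '' Set.Icc 0 (fun _ => C * (‖w‖ + 1))
    with hK
  have hKc : IsClosed K :=
    (isCompact_Icc.image (by fun_prop)).isClosed
  have hwK : w ∈ closure K := by
    rw [Metric.mem_closure_iff] at hw ⊢
    intro ε hε
    obtain ⟨u, ⟨μ, hμ, rfl⟩, hu⟩ := hw (min ε 1) (by positivity)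
    obtain ⟨ν, h1, -, h3, h4⟩ := hC μ hμ
    refine ⟨_, ⟨ν, ⟨fun i => h1 i, fun i => (h4 i).trans ?_⟩, h3⟩,
      hu.trans_le (min_le_left _ _)⟩
    have : ‖∑ i, μ i • a i‖ ≤ ‖w‖ + 1 := by
      have h := norm_le_norm_add_norm_sub w (∑ i, μ i • a i)
      rw [← dist_eq_norm] at h
      linarith [hu.le.trans (min_le_right ε 1)]
    exact mul_le_mul_of_nonneg_left this hC0
  rw [hKc.closure_eq] at hwK
  obtain ⟨μ, hμ, rfl⟩ := hwK
  exact ⟨μ, fun i => hμ.1 i, rfl⟩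

/-- **Farkas' lemma**, for the subfamily of `a` indexed by `J`. -/
theorem exists_conic_combination_of_farkas [InnerProductSpace ℝ E] [CompleteSpace E] (a : ι → E)
    (J : Set ι) (w : E) (h : ∀ d, (∀ i ∈ J, inner ℝ (a i) d ≤ 0) → inner ℝ w d ≤ 0) :
    ∃ μ : ι → ℝ, (∀ i, 0 ≤ μ i) ∧ (∀ i ∉ J, μ i = 0) ∧ w = ∑ i, μ i • a i := by
  classical
  set a' : ι → E := fun i => if i ∈ J then a i else 0 with ha'
  set K : Set E := {w | ∃ μ : ι → ℝ, (∀ i, 0 ≤ μ i) ∧ w = ∑ i, μ i • a' i} with hK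
  suffices hw : w ∈ K by
    obtain ⟨μ, h1, h2⟩ := hw
    refine ⟨fun i => if i ∈ J then μ i else 0, fun i => ?_, fun i hi => by simp [hi], ?_⟩
    · dsimp only
      split_ifs
      exacts [h1 i, le_rfl]
    · rw [h2]
      refine Finset.sum_congr rfl fun i _ => ?_
      simp only [ha']
      split_ifs <;> simp
  have hconv : Convex ℝ K := by
    rintro _ ⟨μ, hμ, rfl⟩ _ ⟨ν, hν, rfl⟩ s t hs ht -
    refine ⟨fun i => s * μ i + t * ν i,
      fun i => add_nonneg (mul_nonneg hs (hμ i)) (mul_nonneg ht (hν i)), ?_⟩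
    simp only [add_smul, mul_smul, Finset.sum_add_distrib, Finset.smul_sum]
  by_contra hw
  obtain ⟨φ, u, h1, h2⟩ :=
    geometric_hahn_banach_closed_point hconv (isClosed_setOf_conic_combination a') hw
  have hu : 0 < u := by simpa using h1 0 ⟨0, by simp, by simp⟩
  set d := (InnerProductSpace.toDual ℝ E).symm φ with hd
  have hφ : ∀ x, φ x = inner ℝ x d := fun x => by
    rw [real_inner_comm, hd, InnerProductSpace.toDual_symm_apply]
  have hd' : ∀ i ∈ J, inner ℝ (a i) d ≤ 0 := by
    intro i hi
    by_contra! hpos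
    -- On this multiple of `a i` the separating functional takes the value `u`, although it is `< u`
    -- on the cone.
    have := h1 ((u / inner ℝ (a i) d) • a i)
      ⟨Pi.single i (u / inner ℝ (a i) d), fun j => ?_, ?_⟩
    · rw [hφ, real_inner_smul_left, div_mul_cancel₀ _ hpos.ne'] at this
      exact lt_irrefl _ this
    · by_cases hj : j = i
      · subst hj
        simp only [Pi.single_eq_same]
        positivity
      · simp [Pi.single_eq_of_ne hj]
    · rw [Finset.sum_eq_single i (fun j _ hj => by simp [Pi.single_eq_of_ne hj]) (by simp)]
      simp [ha', hi]
  have := h d hd'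
  rw [← hφ] at this
  linarith

/-- **Farkas' lemma** with inequalities indexed by `J` and equations indexed by `F`. -/
theorem exists_combination_of_farkas_eq [InnerProductSpace ℝ E] [CompleteSpace E] (a : ι → E)
    (J F : Set ι) (w : E)
    (h : ∀ d, (∀ i ∈ J, inner ℝ (a i) d ≤ 0) → (∀ i ∈ F, inner ℝ (a i) d = 0) →
      inner ℝ w d ≤ 0) :
    ∃ μ : ι → ℝ, (∀ i ∉ F, 0 ≤ μ i) ∧ (∀ i ∉ J ∪ F, μ i = 0) ∧ w = ∑ i, μ i • a i := by
  -- Each equation is a pair of opposite inequalities; the free coefficient is the difference of the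
  -- two nonnegative ones.
  obtain ⟨ν, h1, h2, h3⟩ := exists_conic_combination_of_farkas (Sum.elim a fun i => -a i)
    (Sum.inl '' (J ∪ F) ∪ Sum.inr '' F) w (fun d hd => h d
      (fun i hi => hd (Sum.inl i) (Or.inl ⟨i, Or.inl hi, rfl⟩))
      (fun i hi => le_antisymm (hd (Sum.inl i) (Or.inl ⟨i, Or.inr hi, rfl⟩)) (by
        simpa using hd (Sum.inr i) (Or.inr ⟨i, hi, rfl⟩))))
  have hr : ∀ i ∉ F, ν (Sum.inr i) = 0 := fun i hi => h2 _ (by simpa using hi)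
  refine ⟨fun i => ν (Sum.inl i) - ν (Sum.inr i), fun i hi => ?_, fun i hi => ?_, ?_⟩
  · simpa [hr i hi] using h1 (Sum.inl i)
  · dsimp only
    rw [hr i fun h => hi (Or.inr h), h2 (Sum.inl i) (by simpa using hi), sub_zero]
  · rw [h3, Fintype.sum_sum_type]
    simp [sub_smul, ← sub_eq_add_neg]

end FinitelyGeneratedCone

/-! ### Polyhedra -/

section Polyhedron

open Filter Topology

variable {ι E : Type*} [NormedAddCommGroup E] [InnerProductSpace ℝ E]

theorem isClosed_polyhedron (a : ι → E) (c : ι → ℝ) :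
    IsClosed {x | ∀ i, inner ℝ (a i) x ≤ c i} := by
  simp only [Set.ofPred_forall]
  exact isClosed_iInter fun i => isClosed_le (by fun_prop) continuous_const

theorem convex_polyhedron (a : ι → E) (c : ι → ℝ) :
    Convex ℝ {x | ∀ i, inner ℝ (a i) x ≤ c i} := by
  intro x hx y hy s t hs ht hst i
  rw [inner_add_right, real_inner_smul_right, real_inner_smul_right]
  calc _ ≤ s * c i + t * c i := by gcongr; exacts [hx i, hy i]
    _ = c i := by rw [← add_mul, hst, one_mul]

variable [Fintype ι]

/-- Directions that satisfy the linearized active constraints are feasible for a polyhedron. -/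
theorem eventually_add_smul_mem_polyhedron {a : ι → E} {c : ι → ℝ} {x d : E}
    (hx : ∀ i, inner ℝ (a i) x ≤ c i)
    (hd : ∀ i, inner ℝ (a i) x = c i → inner ℝ (a i) d ≤ 0) :
    ∀ᶠ t : ℝ in 𝓝[>] 0, ∀ i, inner ℝ (a i) (x + t • d) ≤ c i := by
  rw [eventually_all]
  intro i
  rcases (hx i).lt_or_eq with h | h
  · have hc : ContinuousAt (fun t : ℝ => inner ℝ (a i) (x + t • d)) 0 := by fun_prop
    have := hc.eventually (Iio_mem_nhds (by simpa using h))
    exact (this.filter_mono nhdsWithin_le_nhds).mono fun t ht => ht.le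
  · filter_upwards [self_mem_nhdsWithin] with t ht
    rw [inner_add_right, real_inner_smul_right, h]
    have := mul_nonpos_of_nonneg_of_nonpos (le_of_lt ht) (hd i h)
    linarith

/-- A polyhedron is locally a cone: a linearized direction `d` is itself feasible for small steps,
so `t • d` with scalars `t⁻¹` witnesses tangency. -/
theorem mem_bouligandCone_polyhedron_iff {a : ι → E} {c : ι → ℝ} {x d : E}
    (hx : ∀ i, inner ℝ (a i) x ≤ c i) :
    d ∈ bouligandCone {x | ∀ i, inner ℝ (a i) x ≤ c i} x ↔
      ∀ i, inner ℝ (a i) x = c i → inner ℝ (a i) d ≤ 0 := by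
  constructor
  · intro hd i hi
    obtain ⟨α, l, hl, s, e, -, he, hse⟩ := exists_fun_of_mem_tangentConeAt hd
    have hc : Tendsto (fun n => inner ℝ (a i) (s n • e n)) l (𝓝 (inner ℝ (a i) d)) :=
      (Continuous.tendsto (by fun_prop : Continuous fun y => inner ℝ (a i) y) d).comp hse
    refine le_of_tendsto hc (he.mono fun n hn => ?_)
    have h1 := hn i
    rw [inner_add_right, hi] at h1
    have h2 : (s n • e n : E) = (s n : ℝ) • e n := rfl
    rw [h2, real_inner_smul_right]
    exact mul_nonpos_of_nonneg_of_nonpos (s n).2 (by linarith)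
  · intro hd
    have h := eventually_add_smul_mem_polyhedron hx hd
    refine mem_tangentConeAt_of_seq (𝓝[>] (0 : ℝ)) (fun t => (t⁻¹).toNNReal) (fun t => t • d)
      ?_ h ?_
    · have : Tendsto (fun t : ℝ => t • d) (𝓝 0) (𝓝 ((0 : ℝ) • d)) :=
        (by fun_prop : Continuous fun t : ℝ => t • d).tendsto 0
      rw [zero_smul] at this
      exact this.mono_left nhdsWithin_le_nhds
    · refine tendsto_const_nhds.congr' ?_
      filter_upwards [self_mem_nhdsWithin] with t ht
      have ht : 0 < t := ht
      rw [NNReal.smul_def, Real.coe_toNNReal _ (inv_nonneg.2 ht.le), smul_smul,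
        inv_mul_cancel₀ ht.ne', one_smul]

/-- The normal cone of a polyhedron is generated by the normals of the active constraints. -/
theorem exists_conic_combination_of_mem_normalConeAt [CompleteSpace E] {a : ι → E} {c : ι → ℝ}
    {x s : E} (hx : ∀ i, inner ℝ (a i) x ≤ c i)
    (hs : s ∈ normalConeAt {x | ∀ i, inner ℝ (a i) x ≤ c i} x) :
    ∃ μ : ι → ℝ, (∀ i, 0 ≤ μ i) ∧ (∀ i, inner ℝ (a i) x ≠ c i → μ i = 0) ∧
      s = ∑ i, μ i • a i := by
  refine exists_conic_combination_of_farkas a {i | inner ℝ (a i) x = c i} s fun d hd => ?_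
  obtain ⟨t, ht, ht0⟩ :=
    ((eventually_add_smul_mem_polyhedron hx hd).and self_mem_nhdsWithin).exists
  have := hs _ ht
  rw [add_sub_cancel_left, real_inner_smul_right] at this
  exact nonpos_of_mul_nonpos_right this ht0

theorem conic_combination_mem_normalConeAt {a : ι → E} {c : ι → ℝ} {x : E} {μ : ι → ℝ}
    (hμ : ∀ i, 0 ≤ μ i) (hμx : ∀ i, inner ℝ (a i) x ≠ c i → μ i = 0) :
    ∑ i, μ i • a i ∈ normalConeAt {x | ∀ i, inner ℝ (a i) x ≤ c i} x := by
  intro x' hx'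
  rw [sum_inner]
  refine Finset.sum_nonpos fun i _ => ?_
  rw [real_inner_smul_left]
  by_cases h : inner ℝ (a i) x = c i
  · refine mul_nonpos_of_nonneg_of_nonpos (hμ i) ?_
    rw [inner_sub_right, h]
    linarith [hx' i]
  · simp [hμx i h]

/-- **Hoffman's error bound** for systems of linear inequalities. -/
theorem exists_hoffman_bound [FiniteDimensional ℝ E] (a : ι → E) (c : ι → ℝ)
    (hne : {x | ∀ i, inner ℝ (a i) x ≤ c i}.Nonempty) :
    ∃ C : ℝ, 0 ≤ C ∧ ∀ x, ∃ x', (∀ i, inner ℝ (a i) x' ≤ c i) ∧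
      ‖x - x'‖ ≤ C * ∑ i, max 0 (inner ℝ (a i) x - c i) := by
  obtain ⟨C, hC0, hC⟩ := exists_bounded_conic_combination a
  refine ⟨C, hC0, fun x => ?_⟩
  obtain ⟨x', hx', hmin⟩ := exists_norm_eq_iInf_of_complete_convex hne
    (isClosed_polyhedron a c).isComplete (convex_polyhedron a c) x
  -- For the projection `x'`, the residual `x - x'` is normal, hence a conic combination of active
  -- normals. Pairing it with itself bounds `‖x - x'‖²` by the violations weighted with coefficients
  -- of size `O(‖x - x'‖)`.
  rw [norm_eq_iInf_iff_real_inner_le_zero (convex_polyhedron a c) hx'] at hmin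
  refine ⟨x', hx', ?_⟩
  obtain ⟨μ, h1, h2, h3⟩ := exists_conic_combination_of_mem_normalConeAt hx' hmin
  obtain ⟨ν, h4, h5, h6, h7⟩ := hC μ h1
  rw [← h3] at h6 h7
  rcases (norm_nonneg (x - x')).eq_or_lt with h0 | h0
  · rw [← h0]
    exact mul_nonneg hC0 (Finset.sum_nonneg fun i _ => le_max_left _ _)
  refine le_of_mul_le_mul_left ?_ h0
  calc ‖x - x'‖ * ‖x - x'‖ = inner ℝ (∑ i, ν i • a i) (x - x') := by
        rw [h6, real_inner_self_eq_norm_mul_norm]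
    _ = ∑ i, ν i * (inner ℝ (a i) x - c i) := by
        rw [sum_inner]
        refine Finset.sum_congr rfl fun i _ => ?_
        rw [real_inner_smul_left, inner_sub_right]
        by_cases h : inner ℝ (a i) x' = c i
        · rw [h]
        · rw [h5 i (h2 i h), zero_mul, zero_mul]
    _ ≤ ∑ i, C * ‖x - x'‖ * max 0 (inner ℝ (a i) x - c i) := by
        refine Finset.sum_le_sum fun i _ => ?_
        exact (mul_le_mul_of_nonneg_left (le_max_right _ _) (h4 i)).trans
          (mul_le_mul_of_nonneg_right (h7 i) (le_max_left _ _))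
    _ = ‖x - x'‖ * (C * ∑ i, max 0 (inner ℝ (a i) x - c i)) := by
        rw [← Finset.mul_sum]
        ring

end Polyhedron

/-- **Hoffman's error bound** in standard form: the solutions `ξ` of `∑ i, ξ i • b i = h` that are
nonnegative on `J` and vanish on `Z`. -/
theorem exists_hoffman_bound_conic_system {ι : Type*} [Fintype ι] {n : ℕ}
    (b : ι → EuclideanSpace ℝ (Fin n)) (J Z : Set ι) (hZJ : Z ⊆ J) (h : EuclideanSpace ℝ (Fin n))
    (hne : ∃ ξ : ι → ℝ, (∀ i ∈ J, 0 ≤ ξ i) ∧ (∀ i ∈ Z, ξ i = 0) ∧ ∑ i, ξ i • b i = h) :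
    ∃ C : ℝ, 0 ≤ C ∧ ∀ ξ : ι → ℝ, (∀ i ∈ J, 0 ≤ ξ i) → (∀ i ∈ Z, ξ i = 0) →
      ∃ ξ' : ι → ℝ, (∀ i ∈ J, 0 ≤ ξ' i) ∧ (∀ i ∈ Z, ξ' i = 0) ∧ ∑ i, ξ' i • b i = h ∧
        ∀ i, |ξ i - ξ' i| ≤ C * ‖∑ i, ξ i • b i - h‖ := by
  classical
  -- `β j` is the `j`-th row of the matrix with columns `b i`. Each equation becomes two
  -- inequalities, and vanishing on `Z` is encoded as `≤ 0`, which suffices because `Z ⊆ J`. Rows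
  -- not needed are set to zero.
  let β : Fin n → EuclideanSpace ℝ ι := fun j => WithLp.toLp 2 fun i => b i j
  let a : (Fin n ⊕ Fin n) ⊕ (ι ⊕ ι) → EuclideanSpace ℝ ι :=
    Sum.elim (Sum.elim β fun j => -β j)
      (Sum.elim (fun i => if i ∈ J then -EuclideanSpace.single i 1 else 0)
        (fun i => if i ∈ Z then EuclideanSpace.single i 1 else 0))
  let c : (Fin n ⊕ Fin n) ⊕ (ι ⊕ ι) → ℝ := Sum.elim (Sum.elim h fun j => -h j) 0
  have hβ : ∀ (ξ : EuclideanSpace ℝ ι) j, inner ℝ (β j) ξ = (∑ i, ξ i • b i) j := by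
    intro ξ j
    simp [β, PiLp.inner_apply]
  have hJ : ∀ (ξ : EuclideanSpace ℝ ι) i,
      inner ℝ (a (Sum.inr (Sum.inl i))) ξ = if i ∈ J then -ξ i else 0 := by
    intro ξ i
    simp only [a, Sum.elim_inr, Sum.elim_inl]
    split_ifs <;> simp [EuclideanSpace.inner_single_left]
  have hZ : ∀ (ξ : EuclideanSpace ℝ ι) i,
      inner ℝ (a (Sum.inr (Sum.inr i))) ξ = if i ∈ Z then ξ i else 0 := by
    intro ξ i
    simp only [a, Sum.elim_inr]
    split_ifs <;> simp [EuclideanSpace.inner_single_left]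
  have hsol : ∀ ξ : EuclideanSpace ℝ ι, (∀ k, inner ℝ (a k) ξ ≤ c k) ↔
      (∀ i ∈ J, 0 ≤ ξ i) ∧ (∀ i ∈ Z, ξ i = 0) ∧ ∑ i, ξ i • b i = h := by
    intro ξ
    constructor
    · intro H
      have h1 : ∀ i ∈ J, 0 ≤ ξ i := fun i hi => by
        have := H (Sum.inr (Sum.inl i))
        rw [hJ, if_pos hi] at this
        simpa [c] using this
      refine ⟨h1, fun i hi => ?_, ?_⟩
      · have := H (Sum.inr (Sum.inr i))
        rw [hZ, if_pos hi] at this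
        exact le_antisymm (by simpa [c] using this) (h1 i (hZJ hi))
      · ext j
        have h2 := H (Sum.inl (Sum.inl j))
        have h3 := H (Sum.inl (Sum.inr j))
        simp only [a, c, Sum.elim_inl, Sum.elim_inr, inner_neg_left, hβ] at h2 h3
        linarith
    · rintro ⟨h1, h2, h3⟩ ((j | j) | (i | i))
      · simp [a, c, hβ, ← h3]
      · simp [a, c, hβ, ← h3]
      · rw [hJ]
        split_ifs with hi
        · simpa [c] using h1 i hi
        · simp [c]
      · rw [hZ]
        split_ifs with hi
        · simp [c, h2 i hi]
        · simp [c]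
  obtain ⟨ξ₀, h0⟩ := hne
  obtain ⟨C, hC0, hC⟩ := exists_hoffman_bound a c ⟨WithLp.toLp 2 ξ₀, (hsol _).2 h0⟩
  -- Only the `2 * n` inequalities coming from the equations can be violated, each by at most the
  -- norm of the residual.
  refine ⟨C * (2 * n), by positivity, fun ξ h1 h2 => ?_⟩
  obtain ⟨ξ', h3, h4⟩ := hC (WithLp.toLp 2 ξ)
  obtain ⟨h5, h6, h7⟩ := (hsol ξ').1 h3
  refine ⟨ξ', h5, h6, h7, fun i => ?_⟩
  have hi := PiLp.norm_apply_le (WithLp.toLp 2 ξ - ξ') i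
  refine (le_trans (by simpa using hi) h4).trans ?_
  rw [mul_assoc]
  refine mul_le_mul_of_nonneg_left ?_ hC0
  set ρ := ∑ i, ξ i • b i - h with hρ
  have hj : ∀ j, |(∑ i, ξ i • b i) j - h j| ≤ ‖ρ‖ := fun j => by
    simpa [hρ] using PiLp.norm_apply_le ρ j
  have e1 : ∀ j, max 0 (inner ℝ (a (Sum.inl (Sum.inl j))) (WithLp.toLp 2 ξ) -
      c (Sum.inl (Sum.inl j))) ≤ ‖ρ‖ := fun j => by
    refine max_le (norm_nonneg _) ?_
    simp only [a, c, Sum.elim_inl, hβ]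
    exact (le_abs_self _).trans (hj j)
  have e2 : ∀ j, max 0 (inner ℝ (a (Sum.inl (Sum.inr j))) (WithLp.toLp 2 ξ) -
      c (Sum.inl (Sum.inr j))) ≤ ‖ρ‖ := fun j => by
    refine max_le (norm_nonneg _) ?_
    simp only [a, c, Sum.elim_inl, Sum.elim_inr, inner_neg_left, hβ]
    have := (neg_le_abs _).trans (hj j)
    linarith
  have e3 : ∀ i, max 0 (inner ℝ (a (Sum.inr (Sum.inl i))) (WithLp.toLp 2 ξ) -
      c (Sum.inr (Sum.inl i))) = 0 := fun i => by
    rw [hJ]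
    refine max_eq_left ?_
    split_ifs with hi
    · simpa [c] using h1 i hi
    · simp [c]
  have e4 : ∀ i, max 0 (inner ℝ (a (Sum.inr (Sum.inr i))) (WithLp.toLp 2 ξ) -
      c (Sum.inr (Sum.inr i))) = 0 := fun i => by
    rw [hZ]
    refine max_eq_left ?_
    split_ifs with hi
    · simp [c, h2 i hi]
    · simp [c]
  rw [Fintype.sum_sum_type, Fintype.sum_sum_type, Fintype.sum_sum_type]
  simp only [e3, e4, Finset.sum_const_zero, add_zero]
  calc _ ≤ ∑ _j : Fin n, ‖ρ‖ + ∑ _j : Fin n, ‖ρ‖ :=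
        add_le_add (Finset.sum_le_sum fun j _ => e1 j) (Finset.sum_le_sum fun j _ => e2 j)
    _ = 2 * n * ‖ρ‖ := by
        simp
        ring

/-! ### Quadratic expansions and the gradient of the coupling function -/

namespace QCQP

variable {n p m : ℕ} (P : QCQP n p m)

/-- The gradient `∇_x Φ(x, y)` of the coupling function. -/
noncomputable def couplingGradient (x : EuclideanSpace ℝ (Fin n)) (y : DualSpace p m) :
    EuclideanSpace ℝ (Fin n) :=
  toEuclideanLin P.Q₀ x + P.q₀ + toEuclideanLin P.Aᵀ y.fst +
    ∑ i, y.snd i • (toEuclideanLin (P.Q i) x + P.q i)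

theorem inner_toEuclideanLin_transpose {k l : ℕ} (B : Matrix (Fin k) (Fin l) ℝ)
    (v : EuclideanSpace ℝ (Fin k)) (x : EuclideanSpace ℝ (Fin l)) :
    inner ℝ (toEuclideanLin Bᵀ v) x = inner ℝ v (toEuclideanLin B x) := by
  have := toEuclideanLin_conjTranspose_eq_adjoint B
  rw [conjTranspose_eq_transpose_of_trivial] at this
  rw [this, LinearMap.adjoint_inner_left]

theorem _root_.Matrix.PosSemidef.inner_toEuclideanLin_comm {B : Matrix (Fin n) (Fin n) ℝ}
    (hB : B.PosSemidef) (x y : EuclideanSpace ℝ (Fin n)) :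
    inner ℝ x (toEuclideanLin B y) = inner ℝ (toEuclideanLin B x) y :=
  ((isSymmetric_toEuclideanLin_iff.2 hB.1) x y).symm

theorem _root_.Matrix.PosSemidef.inner_toEuclideanLin_nonneg {B : Matrix (Fin n) (Fin n) ℝ}
    (hB : B.PosSemidef) (x : EuclideanSpace ℝ (Fin n)) :
    0 ≤ inner ℝ x (toEuclideanLin B x) := by
  have := (isPositive_toEuclideanLin_iff.2 hB).inner_nonneg_right x
  simpa using this

theorem toEuclideanLin_lagrangianHessian (l : EuclideanSpace ℝ (Fin m))
    (x : EuclideanSpace ℝ (Fin n)) :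
    toEuclideanLin (P.lagrangianHessian l) x =
      toEuclideanLin P.Q₀ x + ∑ i, l i • toEuclideanLin (P.Q i) x := by
  simp [lagrangianHessian]

theorem posSemidef_lagrangianHessian (hQ₀ : P.Q₀.PosSemidef) (hQ : ∀ i, (P.Q i).PosSemidef)
    {l : EuclideanSpace ℝ (Fin m)} (hl : ∀ i, 0 ≤ l i) : (P.lagrangianHessian l).PosSemidef :=
  hQ₀.add (posSemidef_sum _ fun i _ => (hQ i).smul (hl i))

theorem half_quadratic_add {B : Matrix (Fin n) (Fin n) ℝ} (hB : B.PosSemidef)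
    (q : EuclideanSpace ℝ (Fin n)) (r : ℝ) (x h : EuclideanSpace ℝ (Fin n)) :
    1 / 2 * inner ℝ (x + h) (toEuclideanLin B (x + h)) + inner ℝ q (x + h) + r =
      (1 / 2 * inner ℝ x (toEuclideanLin B x) + inner ℝ q x + r) +
        inner ℝ (toEuclideanLin B x + q) h + 1 / 2 * inner ℝ h (toEuclideanLin B h) := by
  rw [map_add, inner_add_left, inner_add_right, inner_add_right, inner_add_right, inner_add_left,
    hB.inner_toEuclideanLin_comm x h, real_inner_comm (toEuclideanLin B x) h]
  ring

theorem f_add (hQ₀ : P.Q₀.PosSemidef) (x h : EuclideanSpace ℝ (Fin n)) :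
    P.f (x + h) = P.f x + inner ℝ (toEuclideanLin P.Q₀ x + P.q₀) h +
      1 / 2 * inner ℝ h (toEuclideanLin P.Q₀ h) :=
  half_quadratic_add hQ₀ _ _ _ _

theorem g_add (hQ : ∀ i, (P.Q i).PosSemidef) (x h : EuclideanSpace ℝ (Fin n)) (i : Fin m) :
    P.g (x + h) i = P.g x i + inner ℝ (toEuclideanLin (P.Q i) x + P.q i) h +
      1 / 2 * inner ℝ h (toEuclideanLin (P.Q i) h) :=
  half_quadratic_add (hQ i) _ _ _ _

theorem coupling_eq (x : EuclideanSpace ℝ (Fin n)) (y : DualSpace p m) :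
    P.coupling x y = P.f x + inner ℝ y.fst (toEuclideanLin P.A x - P.b) +
      ∑ i, y.snd i * P.g x i := by
  simp [coupling, PiLp.inner_apply, mul_comm]

/-- The coupling is quadratic in `x`, so its second-order Taylor expansion is exact. -/
theorem coupling_add (hQ₀ : P.Q₀.PosSemidef) (hQ : ∀ i, (P.Q i).PosSemidef)
    (x h : EuclideanSpace ℝ (Fin n)) (y : DualSpace p m) :
    P.coupling (x + h) y = P.coupling x y + inner ℝ (P.couplingGradient x y) h +
      1 / 2 * inner ℝ h (toEuclideanLin (P.lagrangianHessian y.snd) h) := by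
  simp only [coupling_eq, P.f_add hQ₀, P.g_add hQ, couplingGradient, inner_add_left, sum_inner,
    toEuclideanLin_lagrangianHessian, inner_add_right, inner_sum, real_inner_smul_left,
    real_inner_smul_right, inner_toEuclideanLin_transpose, map_add, inner_sub_right, mul_add,
    Finset.sum_add_distrib, Finset.mul_sum]
  have : ∀ i, y.snd i * (1 / 2 * inner ℝ h (toEuclideanLin (P.Q i) h)) =
    1 / 2 * (y.snd i * inner ℝ h (toEuclideanLin (P.Q i) h)) := fun i => by ring
  simp only [this]
  ring

theorem gradient_coupling (hQ₀ : P.Q₀.PosSemidef) (hQ : ∀ i, (P.Q i).PosSemidef)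
    (x : EuclideanSpace ℝ (Fin n)) (y : DualSpace p m) :
    gradient (fun x' => P.coupling x' y) x = P.couplingGradient x y := by
  refine HasGradientAt.gradient ?_
  rw [hasGradientAt_iff_isLittleO_nhds_zero]
  have h1 : ∀ h, P.coupling (x + h) y - P.coupling x y - inner ℝ (P.couplingGradient x y) h =
      1 / 2 * inner ℝ h (toEuclideanLin (P.lagrangianHessian y.snd) h) := fun h => by
    rw [P.coupling_add hQ₀ hQ]
    ring
  simp only [h1]
  set T := LinearMap.toContinuousLinearMap (toEuclideanLin (P.lagrangianHessian y.snd)) with hT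
  refine (Asymptotics.IsBigO.of_bound (1 / 2 * ‖T‖) (.of_forall fun h => ?_)).trans_isLittleO
    (Asymptotics.isLittleO_norm_pow_id one_lt_two)
  have h2 := norm_inner_le_norm (𝕜 := ℝ) h (T h)
  have h3 := T.le_opNorm h
  have h4 : ‖h‖ * ‖T h‖ ≤ ‖h‖ * (‖T‖ * ‖h‖) := by gcongr
  have h5 : ‖(inner ℝ h (T h) : ℝ)‖ ≤ ‖T‖ * ‖h‖ ^ 2 := by linarith
  simp only [norm_mul, norm_pow, norm_norm]
  norm_num
  change 1 / 2 * ‖(inner ℝ h (T h) : ℝ)‖ ≤ _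
  linarith

end QCQP

/-! ### Subgradients, the KKT map and saddle points -/

namespace QCQP

variable {n p m : ℕ} (P : QCQP n p m)

theorem lagrangian_of_mem {x : EuclideanSpace ℝ (Fin n)} {y : DualSpace p m} (hx : x ∈ P.X)
    (hy : y ∈ dualDomain p m) : P.lagrangian x y = P.coupling x y := by
  simp [lagrangian, indicatorFun, hx, hy]

theorem lagrangian_of_notMem_left {x : EuclideanSpace ℝ (Fin n)} {y : DualSpace p m}
    (hx : x ∉ P.X) (hy : y ∈ dualDomain p m) : P.lagrangian x y = ⊤ := by
  simp [lagrangian, indicatorFun, hx, hy]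

theorem lagrangian_of_notMem_right {x : EuclideanSpace ℝ (Fin n)} {y : DualSpace p m}
    (hx : x ∈ P.X) (hy : y ∉ dualDomain p m) : P.lagrangian x y = ⊥ := by
  simp [lagrangian, indicatorFun, hx, hy]

theorem mem_subdifferential_lagrangian_iff {x s : EuclideanSpace ℝ (Fin n)} {y : DualSpace p m}
    (hx : x ∈ P.X) (hy : y ∈ dualDomain p m) :
    s ∈ subdifferential (fun x => P.lagrangian x y) x ↔
      ∀ x' ∈ P.X, P.coupling x y + inner ℝ s (x' - x) ≤ P.coupling x' y := by
  simp only [subdifferential, Set.mem_ofPred_eq, P.lagrangian_of_mem hx hy]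
  refine forall_congr' fun x' => ?_
  by_cases hx' : x' ∈ P.X
  · simp only [P.lagrangian_of_mem hx' hy, hx', true_imp_iff]
    norm_cast
  · simp [P.lagrangian_of_notMem_left hx' hy, hx']

theorem mem_subdifferential_neg_lagrangian_iff {x : EuclideanSpace ℝ (Fin n)} {y s : DualSpace p m}
    (hx : x ∈ P.X) (hy : y ∈ dualDomain p m) :
    s ∈ subdifferential (fun y => -P.lagrangian x y) y ↔
      ∀ y' ∈ dualDomain p m, P.coupling x y' + inner ℝ s (y' - y) ≤ P.coupling x y := by
  simp only [subdifferential, Set.mem_ofPred_eq, P.lagrangian_of_mem hx hy]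
  refine forall_congr' fun y' => ?_
  by_cases hy' : y' ∈ dualDomain p m
  · simp only [P.lagrangian_of_mem hx hy', hy', true_imp_iff]
    norm_cast
    constructor <;> intro h <;> linarith
  · simp [P.lagrangian_of_notMem_right hx hy', hy']

/-- Along the segment towards `x'` the curvature term is of order `t²`; dividing by `t` and letting
`t → 0` leaves the first-order inequality. -/
theorem mem_normalConeAt_of_subgradient (hQ₀ : P.Q₀.PosSemidef) (hQ : ∀ i, (P.Q i).PosSemidef)
    (hX : Convex ℝ P.X) {x s : EuclideanSpace ℝ (Fin n)} {y : DualSpace p m} (hx : x ∈ P.X)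
    (h : ∀ x' ∈ P.X, P.coupling x y + inner ℝ s (x' - x) ≤ P.coupling x' y) :
    s - P.couplingGradient x y ∈ normalConeAt P.X x := by
  intro x' hx'
  set d := x' - x with hd
  set κ := 1 / 2 * inner ℝ d (toEuclideanLin (P.lagrangianHessian y.snd) d) with hκ
  have h1 : ∀ t ∈ Set.Ioo (0 : ℝ) 1, inner ℝ (s - P.couplingGradient x y) d ≤ t * κ := by
    intro t ht
    have h2 := h (x + t • d) (hX.add_smul_sub_mem hx hx' ⟨ht.1.le, ht.2.le⟩)
    rw [P.coupling_add hQ₀ hQ, add_sub_cancel_left, real_inner_smul_right, real_inner_smul_right,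
      map_smul, real_inner_smul_left, real_inner_smul_right] at h2
    rw [inner_sub_left]
    refine le_of_mul_le_mul_left ?_ ht.1
    rw [hκ]
    linarith
  have h3 : Filter.Tendsto (fun t : ℝ => t * κ) (nhdsWithin 0 (Set.Ioi 0)) (nhds (0 * κ)) :=
    ((by fun_prop : Continuous fun t : ℝ => t * κ).tendsto 0).mono_left nhdsWithin_le_nhds
  rw [zero_mul] at h3
  exact ge_of_tendsto h3 (Filter.eventually_of_mem (Ioo_mem_nhdsGT zero_lt_one) h1)

/-- The curvature term is kept, although plain convexity would discard it: it is the source of the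
growth estimate in `curvature_le_of_mem_kktMap`. -/
theorem subgradient_of_mem_normalConeAt (hQ₀ : P.Q₀.PosSemidef) (hQ : ∀ i, (P.Q i).PosSemidef)
    {x s : EuclideanSpace ℝ (Fin n)} {y : DualSpace p m} (h : s - P.couplingGradient x y ∈ normalConeAt P.X x) :
    ∀ x' ∈ P.X, P.coupling x y + inner ℝ s (x' - x) +
      1 / 2 * inner ℝ (x' - x) (toEuclideanLin (P.lagrangianHessian y.snd) (x' - x)) ≤
        P.coupling x' y := by
  intro x' hx'
  have h1 := h x' hx'
  have h2 := P.coupling_add hQ₀ hQ x (x' - x) y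
  rw [add_sub_cancel] at h2
  rw [inner_sub_left] at h1
  linarith

theorem coupling_sub_coupling (x : EuclideanSpace ℝ (Fin n)) (y y' : DualSpace p m) :
    P.coupling x y' - P.coupling x y =
      inner ℝ (y'.fst - y.fst) (toEuclideanLin P.A x - P.b) +
        ∑ i, (y'.snd i - y.snd i) * P.g x i := by
  simp only [coupling_eq, inner_sub_left, sub_mul, Finset.sum_sub_distrib]
  ring

theorem inner_dualSpace (s t : DualSpace p m) :
    inner ℝ s t = inner ℝ s.fst t.fst + ∑ i, t.snd i * s.snd i := by
  rw [WithLp.prod_inner_apply, PiLp.inner_apply]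
  rfl

/-- The explicit element `(∇_x Φ(x, y), (b - A x, -g x))` of the KKT map. -/
theorem kktMap_nonempty (hQ₀ : P.Q₀.PosSemidef) (hQ : ∀ i, (P.Q i).PosSemidef)
    {z : PDSpace n p m} (hz : z ∈ P.domain) : (P.kktMap z).Nonempty := by
  refine ⟨WithLp.toLp 2 (P.couplingGradient z.fst z.snd,
    WithLp.toLp 2 (-(toEuclideanLin P.A z.fst - P.b), -P.g z.fst)), ?_, ?_⟩
  · rw [P.mem_subdifferential_lagrangian_iff hz.1 hz.2]
    intro x' hx'
    have h1 := P.subgradient_of_mem_normalConeAt hQ₀ hQ (x := z.fst)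
      (s := P.couplingGradient z.fst z.snd) (y := z.snd) (by intro x'; simp) x' hx'
    have h2 := (P.posSemidef_lagrangianHessian hQ₀ hQ hz.2).inner_toEuclideanLin_nonneg
      (x' - z.fst)
    exact le_trans (by simpa using h2) h1
  · rw [P.mem_subdifferential_neg_lagrangian_iff hz.1 hz.2]
    intro y' hy'
    have h1 := P.coupling_sub_coupling z.fst z.snd y'
    have h2 : inner ℝ (WithLp.toLp 2 (-(toEuclideanLin P.A z.fst - P.b), -P.g z.fst) :
        DualSpace p m) (y' - z.snd) =
        -inner ℝ (toEuclideanLin P.A z.fst - P.b) (y'.fst - z.snd.fst) -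
          ∑ i, (y'.snd i - z.snd.snd i) * P.g z.fst i := by
      rw [inner_dualSpace, ← inner_neg_left, sub_eq_add_neg (inner ℝ _ _), ← Finset.sum_neg_distrib]
      simp only [← mul_neg]
      rfl
    rw [real_inner_comm] at h1
    change P.coupling z.fst y' + inner ℝ (WithLp.toLp 2 (-(toEuclideanLin P.A z.fst - P.b),
      -P.g z.fst) : DualSpace p m) (y' - z.snd) ≤ P.coupling z.fst z.snd
    linarith

/-- The coupling is affine in `y`, so the dual subgradient inequality can be tested coordinatewise:
raising `λ_i` by one gives the sign condition, and shifting it by `± λ_i` gives complementarity.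
Moving `v` along the residual gives the equation. -/
theorem kkt_conditions_of_mem_kktMap (hQ₀ : P.Q₀.PosSemidef) (hQ : ∀ i, (P.Q i).PosSemidef)
    (hX : Convex ℝ P.X) {z w : PDSpace n p m} (hz : z ∈ P.domain) (hw : w ∈ P.kktMap z) :
    w.fst - P.couplingGradient z.fst z.snd ∈ normalConeAt P.X z.fst ∧
      toEuclideanLin P.A z.fst - P.b = -w.snd.fst ∧
      (∀ i, P.g z.fst i + w.snd.snd i ≤ 0) ∧
      (∀ i, z.snd.snd i * (P.g z.fst i + w.snd.snd i) = 0) := by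
  have h1 := (P.mem_subdifferential_lagrangian_iff hz.1 hz.2).1 hw.1
  have h2 := (P.mem_subdifferential_neg_lagrangian_iff hz.1 hz.2).1 hw.2
  have h3 : ∀ y' ∈ dualDomain p m,
      inner ℝ (toEuclideanLin P.A z.fst - P.b + w.snd.fst) (y'.fst - z.snd.fst) +
        ∑ i, (y'.snd i - z.snd.snd i) * (P.g z.fst i + w.snd.snd i) ≤ 0 := by
    intro y' hy'
    have h4 := h2 y' hy'
    have h5 := P.coupling_sub_coupling z.fst z.snd y'
    have h6 : inner ℝ w.snd (y' - z.snd) = inner ℝ w.snd.fst (y'.fst - z.snd.fst) +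
        ∑ i, (y'.snd i - z.snd.snd i) * w.snd.snd i :=
      inner_dualSpace _ _
    rw [real_inner_comm] at h5
    simp only [inner_add_left, mul_add, Finset.sum_add_distrib]
    linarith
  have hsingle : ∀ (i : Fin m) (t : ℝ), 0 ≤ z.snd.snd i + t →
      t * (P.g z.fst i + w.snd.snd i) ≤ 0 := by
    intro i t ht
    have := h3 (WithLp.toLp 2 (z.snd.fst, z.snd.snd + EuclideanSpace.single i t)) (fun j => by
      by_cases hj : j = i
      · subst hj
        simpa using ht
      · simpa [hj] using hz.2 j)
    rw [Finset.sum_eq_single i (fun j _ hj => by simp [hj]) (by simp)] at this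
    simpa using this
  refine ⟨P.mem_normalConeAt_of_subgradient hQ₀ hQ hX hz.1 h1, ?_, fun i => ?_, fun i => ?_⟩
  · have := h3 (WithLp.toLp 2 (z.snd.fst + (toEuclideanLin P.A z.fst - P.b + w.snd.fst),
      z.snd.snd)) hz.2
    change inner ℝ _ (z.snd.fst + (toEuclideanLin P.A z.fst - P.b + w.snd.fst) - z.snd.fst) +
      ∑ i, (z.snd.snd i - z.snd.snd i) * _ ≤ 0 at this
    simp only [add_sub_cancel_left, sub_self, zero_mul, Finset.sum_const_zero, add_zero,
      real_inner_self_nonpos] at this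
    exact eq_neg_of_add_eq_zero_left this
  · have := hsingle i 1 (by linarith [hz.2 i])
    linarith
  · have h4 := hsingle i (z.snd.snd i) (by linarith [hz.2 i])
    have h5 := hsingle i (-z.snd.snd i) (by simp)
    linarith

/-- At a feasible point all products `λ_i g_i` are nonpositive, so their sum vanishes only if each
does. -/
theorem mem_multipliers_iff (hQ₀ : P.Q₀.PosSemidef) (hQ : ∀ i, (P.Q i).PosSemidef)
    {x : EuclideanSpace ℝ (Fin n)} (hx : x ∈ P.feasible) {y : DualSpace p m} :
    y ∈ P.multipliers x ↔ y ∈ dualDomain p m ∧ -P.couplingGradient x y ∈ normalConeAt P.X x ∧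
      ∀ i, y.snd i * P.g x i = 0 := by
  simp only [multipliers, Set.mem_ofPred_eq, P.gradient_coupling hQ₀ hQ]
  refine and_congr_right fun hy => and_congr_right fun _ => ?_
  have h1 : inner ℝ y.snd (P.g x) = ∑ i, y.snd i * P.g x i := by
    simp [PiLp.inner_apply, mul_comm]
  rw [h1, Finset.sum_eq_zero_iff_of_nonpos
    (fun i _ => mul_nonpos_of_nonneg_of_nonpos (hy i) (hx.2.2 i))]
  simp

theorem coupling_le_of_feasible {x : EuclideanSpace ℝ (Fin n)} (hx : x ∈ P.feasible)
    {y : DualSpace p m} (hy : y ∈ dualDomain p m) : P.coupling x y ≤ P.f x := by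
  rw [coupling_eq, hx.2.1, sub_self, inner_zero_right]
  linarith [Finset.sum_nonpos fun i (_ : i ∈ Finset.univ) =>
    mul_nonpos_of_nonneg_of_nonpos (hy i) (hx.2.2 i)]

theorem coupling_eq_of_complementary {x : EuclideanSpace ℝ (Fin n)} (hx : x ∈ P.feasible)
    {y : DualSpace p m} (h : ∀ i, y.snd i * P.g x i = 0) : P.coupling x y = P.f x := by
  simp [coupling_eq, hx.2.1, h]

theorem f_le_coupling_of_mem_multipliers (hQ₀ : P.Q₀.PosSemidef) (hQ : ∀ i, (P.Q i).PosSemidef)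
    {x x' : EuclideanSpace ℝ (Fin n)} (hx : x ∈ P.feasible) {y : DualSpace p m}
    (hy : y ∈ P.multipliers x) (hx' : x' ∈ P.X) : P.f x ≤ P.coupling x' y := by
  obtain ⟨h1, h2, h3⟩ := (P.mem_multipliers_iff hQ₀ hQ hx).1 hy
  have h4 := P.subgradient_of_mem_normalConeAt hQ₀ hQ (s := 0) (by simpa using h2) x' hx'
  have h5 := (P.posSemidef_lagrangianHessian hQ₀ hQ h1).inner_toEuclideanLin_nonneg (x' - x)
  rw [P.coupling_eq_of_complementary hx h3, inner_zero_left] at h4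
  linarith

/-- A feasible point together with one of its multipliers is a saddle point. -/
theorem mem_saddleSet_of_mem_multipliers (hQ₀ : P.Q₀.PosSemidef) (hQ : ∀ i, (P.Q i).PosSemidef)
    {x : EuclideanSpace ℝ (Fin n)} (hx : x ∈ P.feasible) {y : DualSpace p m}
    (hy : y ∈ P.multipliers x) : (WithLp.toLp 2 (x, y) : PDSpace n p m) ∈ P.saddleSet := by
  obtain ⟨h1, -, h3⟩ := (P.mem_multipliers_iff hQ₀ hQ hx).1 hy
  refine ⟨⟨hx.1, h1⟩, fun y' => ?_, fun x' => ?_⟩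
  · change P.lagrangian x y' ≤ P.lagrangian x y
    by_cases hy' : y' ∈ dualDomain p m
    · rw [P.lagrangian_of_mem hx.1 hy', P.lagrangian_of_mem hx.1 h1, EReal.coe_le_coe_iff,
        P.coupling_eq_of_complementary hx h3]
      exact P.coupling_le_of_feasible hx hy'
    · simp [P.lagrangian_of_notMem_right hx.1 hy']
  · change P.lagrangian x y ≤ P.lagrangian x' y
    by_cases hx' : x' ∈ P.X
    · rw [P.lagrangian_of_mem hx.1 h1, P.lagrangian_of_mem hx' h1, EReal.coe_le_coe_iff,
        P.coupling_eq_of_complementary hx h3]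
      exact P.f_le_coupling_of_mem_multipliers hQ₀ hQ hx hy hx'
    · simp [P.lagrangian_of_notMem_left hx' h1]

/-- Strong monotonicity estimate of the KKT map along the curvature of the Lagrangian. -/
theorem curvature_le_of_mem_kktMap (hQ₀ : P.Q₀.PosSemidef) (hQ : ∀ i, (P.Q i).PosSemidef)
    (hX : Convex ℝ P.X) {x : EuclideanSpace ℝ (Fin n)} (hx : x ∈ P.feasible) {y : DualSpace p m}
    (hy : y ∈ P.multipliers x) {z w : PDSpace n p m} (hz : z ∈ P.domain) (hw : w ∈ P.kktMap z) :
    1 / 2 * inner ℝ (z.fst - x) (toEuclideanLin (P.lagrangianHessian z.snd.snd) (z.fst - x)) ≤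
      ‖w‖ * (‖z.fst - x‖ + ‖z.snd - y‖) := by
  -- In the sum of `h1` to `h4` all coupling values and `P.f x` cancel, leaving the curvature
  -- against the pairings of `w` with the displacements.
  have h1 := P.subgradient_of_mem_normalConeAt hQ₀ hQ
    (P.kkt_conditions_of_mem_kktMap hQ₀ hQ hX hz hw).1 x hx.1
  have h2 := (P.mem_subdifferential_neg_lagrangian_iff hz.1 hz.2).1 hw.2 y hy.1
  have h3 := P.f_le_coupling_of_mem_multipliers hQ₀ hQ hx hy hz.1
  have h4 := P.coupling_le_of_feasible hx hz.2
  have h5 : inner ℝ w.fst (z.fst - x) ≤ ‖w‖ * ‖z.fst - x‖ :=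
    (real_inner_le_norm _ _).trans (by gcongr; exact WithLp.norm_fst_le _ w)
  have h6 : inner ℝ w.snd (z.snd - y) ≤ ‖w‖ * ‖z.snd - y‖ :=
    (real_inner_le_norm _ _).trans (by gcongr; exact WithLp.norm_snd_le _ w)
  rw [← neg_sub z.fst x, map_neg, inner_neg_neg, inner_neg_right] at h1
  rw [← neg_sub z.snd y, inner_neg_right] at h2
  linarith

end QCQP

/-! ### Normal cones and norm comparisons -/

section NormalCone

variable {E : Type*} [NormedAddCommGroup E] [InnerProductSpace ℝ E]

theorem isClosed_normalConeAt (C : Set E) (x : E) : IsClosed (normalConeAt C x) := by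
  simp only [normalConeAt, Set.ofPred_forall]
  exact isClosed_iInter fun x' => isClosed_iInter fun _ =>
    isClosed_le (by fun_prop) continuous_const

theorem smul_mem_normalConeAt {C : Set E} {x s : E} (hs : s ∈ normalConeAt C x) {t : ℝ}
    (ht : 0 ≤ t) : t • s ∈ normalConeAt C x := by
  intro x' hx'
  rw [real_inner_smul_left]
  exact mul_nonpos_of_nonneg_of_nonpos ht (hs x' hx')

theorem inner_nonpos_of_mem_normalConeAt_polyhedron [CompleteSpace E] {ι : Type*} [Fintype ι]
    {a : ι → E} {c : ι → ℝ} {x s d : E} (hx : ∀ i, inner ℝ (a i) x ≤ c i)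
    (hs : s ∈ normalConeAt {x | ∀ i, inner ℝ (a i) x ≤ c i} x)
    (hd : ∀ i, inner ℝ (a i) x = c i → inner ℝ (a i) d ≤ 0) : inner ℝ s d ≤ 0 := by
  obtain ⟨μ, h1, h2, rfl⟩ := exists_conic_combination_of_mem_normalConeAt hx hs
  rw [sum_inner]
  refine Finset.sum_nonpos fun i _ => ?_
  rw [real_inner_smul_left]
  by_cases h : inner ℝ (a i) x = c i
  · exact mul_nonpos_of_nonneg_of_nonpos (h1 i) (hd i h)
  · simp [h2 i h]

end NormalCone

theorem EuclideanSpace.norm_le_sum_abs {ι : Type*} [Fintype ι] (x : EuclideanSpace ℝ ι) :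
    ‖x‖ ≤ ∑ i, |x i| := by
  classical
  have h : x = ∑ i, EuclideanSpace.single i (x i) := by
    ext j
    simp [Finset.sum_apply, Pi.single_apply]
  calc ‖x‖ = ‖∑ i, EuclideanSpace.single i (x i)‖ := by rw [← h]
    _ ≤ ∑ i, |x i| := (norm_sum_le _ _).trans (by simp)

theorem WithLp.norm_le_norm_fst_add_norm_snd {E F : Type*} [NormedAddCommGroup E]
    [NormedAddCommGroup F] (x : WithLp 2 (E × F)) : ‖x‖ ≤ ‖x.fst‖ + ‖x.snd‖ := by
  have h : x = WithLp.toLp 2 (x.fst, 0) + WithLp.toLp 2 (0, x.snd) := by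
    rw [← WithLp.toLp_add, Prod.mk_add_mk, add_zero, zero_add]
    rfl
  calc ‖x‖ = ‖WithLp.toLp 2 (x.fst, (0 : F)) + WithLp.toLp 2 ((0 : E), x.snd)‖ := by rw [← h]
    _ ≤ ‖x.fst‖ + ‖x.snd‖ := (norm_add_le _ _).trans_eq (by
        rw [WithLp.norm_toLp_fst, WithLp.norm_toLp_snd])

/-! ### Existence and boundedness of multipliers under MFCQ -/

namespace QCQP

open Filter Topology

variable {n p m : ℕ} (P : QCQP n p m)

/-- The polyhedron normals, the rows of `A` and the gradients of the constraints at `x`. -/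
noncomputable def constraintNormal {k : ℕ} (a : Fin k → EuclideanSpace ℝ (Fin n))
    (x : EuclideanSpace ℝ (Fin n)) : Fin k ⊕ (Fin p ⊕ Fin m) → EuclideanSpace ℝ (Fin n) :=
  Sum.elim a (Sum.elim (fun r => toEuclideanLin P.Aᵀ (EuclideanSpace.single r 1))
    (fun i => toEuclideanLin (P.Q i) x + P.q i))

theorem sum_smul_constraintNormal {k : ℕ} (a : Fin k → EuclideanSpace ℝ (Fin n))
    (x : EuclideanSpace ℝ (Fin n)) (ξ : Fin k ⊕ (Fin p ⊕ Fin m) → ℝ) :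
    ∑ i, ξ i • P.constraintNormal a x i = ∑ j, ξ (Sum.inl j) • a j +
      (toEuclideanLin P.Aᵀ (WithLp.toLp 2 fun r => ξ (Sum.inr (Sum.inl r))) +
        ∑ i, ξ (Sum.inr (Sum.inr i)) • (toEuclideanLin (P.Q i) x + P.q i)) := by
  rw [Fintype.sum_sum_type, Fintype.sum_sum_type]
  simp only [constraintNormal, Sum.elim_inl, Sum.elim_inr, ← map_smul, ← map_sum]
  congr 3
  ext r
  simp [Finset.sum_apply, Pi.single_apply]

theorem inner_constraintNormal_row {k : ℕ} (a : Fin k → EuclideanSpace ℝ (Fin n))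
    (x d : EuclideanSpace ℝ (Fin n)) (r : Fin p) :
    inner ℝ (P.constraintNormal a x (Sum.inr (Sum.inl r))) d = toEuclideanLin P.A d r := by
  simp [constraintNormal, inner_toEuclideanLin_transpose, EuclideanSpace.inner_single_left]

/-- The sign-constrained coefficients of `constraintNormal`. -/
def signConstrained (k p m : ℕ) : Set (Fin k ⊕ (Fin p ⊕ Fin m)) :=
  {i | ∀ r, i ≠ Sum.inr (Sum.inl r)}

/-- The coefficients of `constraintNormal` that belong to inactive constraints. -/
def inactive {k : ℕ} (a : Fin k → EuclideanSpace ℝ (Fin n)) (c : Fin k → ℝ)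
    (x : EuclideanSpace ℝ (Fin n)) : Set (Fin k ⊕ (Fin p ⊕ Fin m)) :=
  {i | Sum.elim (fun j => inner ℝ (a j) x ≠ c j)
    (Sum.elim (fun _ => False) (fun i => P.g x i ≠ 0)) i}

section

variable {k : ℕ} {a : Fin k → EuclideanSpace ℝ (Fin n)} {c : Fin k → ℝ}
  {x : EuclideanSpace ℝ (Fin n)}

theorem mem_multipliers_of_combination (hQ₀ : P.Q₀.PosSemidef) (hQ : ∀ i, (P.Q i).PosSemidef)
    (hX : P.X = {x | ∀ i, inner ℝ (a i) x ≤ c i}) (hx : x ∈ P.feasible)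
    {ξ : Fin k ⊕ (Fin p ⊕ Fin m) → ℝ} (h1 : ∀ i ∈ signConstrained k p m, 0 ≤ ξ i)
    (h2 : ∀ i ∈ P.inactive a c x, ξ i = 0)
    (h3 : ∑ i, ξ i • P.constraintNormal a x i = -(toEuclideanLin P.Q₀ x + P.q₀)) :
    (WithLp.toLp 2 (WithLp.toLp 2 fun r => ξ (Sum.inr (Sum.inl r)),
      WithLp.toLp 2 fun i => ξ (Sum.inr (Sum.inr i))) : DualSpace p m) ∈ P.multipliers x := by
  rw [P.mem_multipliers_iff hQ₀ hQ hx]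
  refine ⟨fun i => h1 _ (by simp [signConstrained]), ?_, fun i => ?_⟩
  · rw [sum_smul_constraintNormal] at h3
    have : -P.couplingGradient x (WithLp.toLp 2 (WithLp.toLp 2 fun r => ξ (Sum.inr (Sum.inl r)),
        WithLp.toLp 2 fun i => ξ (Sum.inr (Sum.inr i)))) = ∑ j, ξ (Sum.inl j) • a j := by
      rw [eq_comm, ← sub_eq_zero] at h3
      rw [neg_eq_iff_add_eq_zero, ← neg_eq_zero, ← h3]
      change -(toEuclideanLin P.Q₀ x + P.q₀ +
        toEuclideanLin P.Aᵀ (WithLp.toLp 2 fun r => ξ (Sum.inr (Sum.inl r))) +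
        ∑ i, ξ (Sum.inr (Sum.inr i)) • (toEuclideanLin (P.Q i) x + P.q i) +
        ∑ j, ξ (Sum.inl j) • a j) = _
      abel
    rw [this, hX]
    exact conic_combination_mem_normalConeAt (fun j => h1 _ (by simp [signConstrained]))
      (fun j hj => h2 _ hj)
  · by_cases h : P.g x i = 0
    · simp [h]
    · have := h2 (Sum.inr (Sum.inr i)) h
      simp [this]

/-- Adding a small multiple `s • e` of the MFCQ direction makes the active constraints strictly
decreasing, so `d + s • e` is a truly feasible direction and optimality applies; then `s → 0`. -/
theorem inner_gradient_nonneg_of_linearized (hQ₀ : P.Q₀.PosSemidef)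
    (hQ : ∀ i, (P.Q i).PosSemidef) (hX : P.X = {x | ∀ i, inner ℝ (a i) x ≤ c i})
    (hopt : P.IsOptimal x) (hMFCQ : P.MFCQ x) {d : EuclideanSpace ℝ (Fin n)}
    (hda : ∀ i, inner ℝ (a i) x = c i → inner ℝ (a i) d ≤ 0)
    (hdA : toEuclideanLin P.A d = 0)
    (hdg : ∀ i, P.g x i = 0 → inner ℝ (toEuclideanLin (P.Q i) x + P.q i) d ≤ 0) :
    0 ≤ inner ℝ (toEuclideanLin P.Q₀ x + P.q₀) d := by
  obtain ⟨⟨hxX, hxA, hxg⟩, hmin⟩ := hopt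
  obtain ⟨-, e, heT, heA, heg⟩ := hMFCQ
  have hxX' : ∀ i, inner ℝ (a i) x ≤ c i := by rw [hX] at hxX; exact hxX
  rw [hX, mem_bouligandCone_polyhedron_iff hxX'] at heT
  have main : ∀ s : ℝ, 0 < s → 0 ≤ inner ℝ (toEuclideanLin P.Q₀ x + P.q₀) (d + s • e) := by
    intro s hs
    set u := d + s • e with hu
    have h1 : ∀ᶠ t : ℝ in 𝓝[>] 0, ∀ i, inner ℝ (a i) (x + t • u) ≤ c i :=
      eventually_add_smul_mem_polyhedron hxX' fun i hi => by
        rw [hu, inner_add_right, real_inner_smul_right]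
        linarith [hda i hi, mul_nonpos_of_nonneg_of_nonpos hs.le (heT i hi)]
    have h2 : ∀ᶠ t : ℝ in 𝓝[>] 0, ∀ i, P.g (x + t • u) i ≤ 0 := by
      rw [eventually_all]
      intro i
      have hexp : ∀ t : ℝ, P.g (x + t • u) i = P.g x i +
          t * (inner ℝ (toEuclideanLin (P.Q i) x + P.q i) u +
            t * (1 / 2 * inner ℝ u (toEuclideanLin (P.Q i) u))) := fun t => by
        rw [P.g_add hQ, map_smul, real_inner_smul_left, real_inner_smul_right,
          real_inner_smul_right]
        ring
      simp only [hexp]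
      rcases (hxg i).lt_or_eq with h | h
      · have hc : ContinuousAt (fun t : ℝ => P.g x i +
          t * (inner ℝ (toEuclideanLin (P.Q i) x + P.q i) u +
            t * (1 / 2 * inner ℝ u (toEuclideanLin (P.Q i) u)))) 0 := by fun_prop
        have := hc.eventually (Iio_mem_nhds (by simpa using h))
        exact (this.filter_mono nhdsWithin_le_nhds).mono fun t ht => le_of_lt ht
      · have hneg : inner ℝ (toEuclideanLin (P.Q i) x + P.q i) u < 0 := by
          rw [hu, inner_add_right, real_inner_smul_right]
          linarith [hdg i h, mul_neg_of_pos_of_neg hs (heg i h)]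
        have hc : ContinuousAt (fun t : ℝ => inner ℝ (toEuclideanLin (P.Q i) x + P.q i) u +
            t * (1 / 2 * inner ℝ u (toEuclideanLin (P.Q i) u))) 0 := by fun_prop
        have := hc.eventually_lt (continuousAt_const (y := (0 : ℝ))) (by simpa using hneg)
        filter_upwards [this.filter_mono nhdsWithin_le_nhds, self_mem_nhdsWithin] with t ht ht0
        rw [h, zero_add]
        exact mul_nonpos_of_nonneg_of_nonpos (le_of_lt ht0) (le_of_lt ht)
    have h3 : ∀ᶠ t : ℝ in 𝓝[>] 0, 0 ≤ inner ℝ (toEuclideanLin P.Q₀ x + P.q₀) u +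
        t * (1 / 2 * inner ℝ u (toEuclideanLin P.Q₀ u)) := by
      filter_upwards [h1, h2, self_mem_nhdsWithin] with t ht1 ht2 ht0
      have ht0 : 0 < t := ht0
      have := hmin (x + t • u) ⟨by rw [hX]; exact ht1, by simp [hu, hdA, heA, hxA], ht2⟩
      rw [P.f_add hQ₀, map_smul, real_inner_smul_left, real_inner_smul_right,
        real_inner_smul_right] at this
      refine le_of_mul_le_mul_left ?_ ht0
      linarith
    have h4 : Tendsto (fun t : ℝ => inner ℝ (toEuclideanLin P.Q₀ x + P.q₀) u +
        t * (1 / 2 * inner ℝ u (toEuclideanLin P.Q₀ u))) (𝓝[>] 0)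
        (𝓝 (inner ℝ (toEuclideanLin P.Q₀ x + P.q₀) u +
          0 * (1 / 2 * inner ℝ u (toEuclideanLin P.Q₀ u)))) :=
      (Continuous.tendsto (by fun_prop) 0).mono_left nhdsWithin_le_nhds
    rw [zero_mul, add_zero] at h4
    exact ge_of_tendsto h4 h3
  have h5 : Tendsto (fun s : ℝ => inner ℝ (toEuclideanLin P.Q₀ x + P.q₀) (d + s • e)) (𝓝[>] 0)
      (𝓝 (inner ℝ (toEuclideanLin P.Q₀ x + P.q₀) (d + (0 : ℝ) • e))) :=
    (Continuous.tendsto (by fun_prop) 0).mono_left nhdsWithin_le_nhds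
  rw [zero_smul, add_zero] at h5
  exact ge_of_tendsto h5 (eventually_mem_nhdsWithin.mono fun s hs => main s hs)

/-- Existence of multipliers under MFCQ. -/
theorem multipliers_nonempty (hQ₀ : P.Q₀.PosSemidef) (hQ : ∀ i, (P.Q i).PosSemidef)
    (hX : P.X = {x | ∀ i, inner ℝ (a i) x ≤ c i}) (hopt : P.IsOptimal x) (hMFCQ : P.MFCQ x) :
    (P.multipliers x).Nonempty := by
  obtain ⟨ξ, h1, h2, h3⟩ := exists_combination_of_farkas_eq (P.constraintNormal a x)
    (signConstrained k p m \ P.inactive a c x) (signConstrained k p m)ᶜ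
    (-(toEuclideanLin P.Q₀ x + P.q₀)) (fun d hd hdA => by
      rw [inner_neg_left, neg_nonpos]
      refine P.inner_gradient_nonneg_of_linearized hQ₀ hQ hX hopt hMFCQ (fun j hj => ?_) ?_
        (fun i hi => ?_)
      · exact hd (Sum.inl j) ⟨by simp [signConstrained], by simp [inactive, hj]⟩
      · ext r
        rw [← P.inner_constraintNormal_row a x]
        exact hdA _ (by simp [signConstrained])
      · exact hd (Sum.inr (Sum.inr i)) ⟨by simp [signConstrained], by simp [inactive, hi]⟩)
  refine ⟨_, P.mem_multipliers_of_combination hQ₀ hQ hX hopt.1 (fun i hi => h1 i (by simpa))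
    (fun i hi => h2 i ?_) h3.symm⟩
  rintro (h | h)
  · exact h.2 hi
  · refine h fun r hr => ?_
    subst hr
    exact hi

/-- Boundedness of the multiplier set under MFCQ. -/
theorem isBounded_multipliers (hQ₀ : P.Q₀.PosSemidef) (hQ : ∀ i, (P.Q i).PosSemidef)
    (hX : P.X = {x | ∀ i, inner ℝ (a i) x ≤ c i}) (hx : x ∈ P.feasible) (hMFCQ : P.MFCQ x) :
    Bornology.IsBounded (P.multipliers x) := by
  obtain ⟨hi, e, heT, heA, heg⟩ := hMFCQ
  have hxX : ∀ i, inner ℝ (a i) x ≤ c i := by have := hx.1; rw [hX] at this; exact this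
  rw [hX, mem_bouligandCone_polyhedron_iff hxX] at heT
  set G₀ := toEuclideanLin P.Q₀ x + P.q₀ with hG₀
  set G := fun i => toEuclideanLin (P.Q i) x + P.q i with hG
  -- Stationarity tested against the MFCQ direction `e` bounds each active `λ_i`, because all terms
  -- `λ_j ⟨G j, e⟩` have the same sign.
  have hl : ∃ L : Fin m → ℝ, ∀ y ∈ P.multipliers x, ∀ i, y.snd i ≤ L i := by
    refine ⟨fun i => max 0 (inner ℝ G₀ e / -inner ℝ (G i) e), fun y hy i => ?_⟩
    obtain ⟨h1, h2, h3⟩ := (P.mem_multipliers_iff hQ₀ hQ hx).1 hy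
    rw [hX] at h2
    have h4 := inner_nonpos_of_mem_normalConeAt_polyhedron hxX h2 heT
    have h5 : inner ℝ (P.couplingGradient x y) e =
        inner ℝ G₀ e + ∑ i, y.snd i * inner ℝ (G i) e := by
      rw [couplingGradient, inner_add_left, inner_add_left, inner_toEuclideanLin_transpose, heA,
        inner_zero_right, add_zero, sum_inner]
      simp only [real_inner_smul_left, hG, hG₀]
    have h6 : ∀ j, y.snd j * inner ℝ (G j) e ≤ 0 := fun j => by
      by_cases hj : P.g x j = 0
      · exact mul_nonpos_of_nonneg_of_nonpos (h1 j) (heg j hj).le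
      · rw [(mul_eq_zero.1 (h3 j)).resolve_right hj, zero_mul]
    by_cases hgi : P.g x i = 0
    · refine le_max_of_le_right ?_
      rw [le_div_iff₀ (neg_pos.2 (heg i hgi))]
      have h7 : ∑ j, y.snd j * inner ℝ (G j) e ≤ y.snd i * inner ℝ (G i) e := by
        have := Finset.single_le_sum (f := fun j => -(y.snd j * inner ℝ (G j) e))
          (fun j _ => neg_nonneg.2 (h6 j)) (Finset.mem_univ i)
        rw [Finset.sum_neg_distrib] at this
        linarith
      rw [inner_neg_left, h5] at h4
      linarith
    · rw [(mul_eq_zero.1 (h3 i)).resolve_right hgi]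
      exact le_max_left _ _
  -- Part (i) of MFCQ says that `-Aᵀ v` avoids the closed normal cone for unit `v`. Compactness of
  -- the sphere makes the distance uniform, and homogeneity extends it to all `v`.
  have hv : ∃ δ : ℝ, 0 < δ ∧ ∀ v : EuclideanSpace ℝ (Fin p), ∀ s ∈ normalConeAt P.X x,
      δ * ‖v‖ ≤ ‖toEuclideanLin P.Aᵀ v + s‖ := by
    have h0 : (0 : EuclideanSpace ℝ (Fin n)) ∈ normalConeAt P.X x := by intro x'; simp
    have hcont : Continuous fun v : EuclideanSpace ℝ (Fin p) => toEuclideanLin P.Aᵀ v :=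
      LinearMap.continuous_of_finiteDimensional _
    have hδ : ∃ δ : ℝ, 0 < δ ∧ ∀ v : EuclideanSpace ℝ (Fin p), ‖v‖ = 1 →
        δ ≤ Metric.infDist (-toEuclideanLin P.Aᵀ v) (normalConeAt P.X x) := by
      rcases (Metric.sphere (0 : EuclideanSpace ℝ (Fin p)) 1).eq_empty_or_nonempty with h | h
      · refine ⟨1, one_pos, fun v hv => ?_⟩
        have : v ∈ Metric.sphere (0 : EuclideanSpace ℝ (Fin p)) 1 := by simpa using hv
        rw [h] at this
        exact absurd this (Set.notMem_empty v)
      · obtain ⟨v₀, hv₀, hmin⟩ := (isCompact_sphere (0 : EuclideanSpace ℝ (Fin p))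
          1).exists_isMinOn h ((Metric.continuous_infDist_pt
            (normalConeAt P.X x)).comp hcont.neg).continuousOn
        refine ⟨_, ?_, fun v hv => hmin (by simpa using hv)⟩
        refine ((isClosed_normalConeAt _ _).notMem_iff_infDist_pos ⟨0, h0⟩).1 fun hmem => ?_
        have := (hi v₀ _ hmem (add_neg_cancel _)).1
        rw [this] at hv₀
        simp at hv₀
    obtain ⟨δ, hδ0, hδ⟩ := hδ
    refine ⟨δ, hδ0, fun v s hs => ?_⟩
    rcases eq_or_ne v 0 with rfl | hv
    · simp
    have hv' : 0 < ‖v‖ := norm_pos_iff.2 hv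
    have h1 := hδ (‖v‖⁻¹ • v) (by rw [norm_smul, norm_inv, norm_norm, inv_mul_cancel₀ hv'.ne'])
    have h2 := h1.trans (Metric.infDist_le_dist_of_mem
      (smul_mem_normalConeAt hs (inv_nonneg.2 hv'.le)))
    rw [dist_eq_norm, map_smul, ← smul_neg, ← smul_sub, norm_smul, norm_inv, norm_norm,
      ← neg_add', norm_neg, inv_mul_eq_div, le_div_iff₀ hv'] at h2
    exact h2
  obtain ⟨L, hL⟩ := hl
  obtain ⟨δ, hδ0, hδ⟩ := hv
  rw [isBounded_iff_forall_norm_le]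
  refine ⟨(‖G₀‖ + ∑ i, L i * ‖G i‖) / δ + ∑ i, L i, fun y hy => ?_⟩
  obtain ⟨h1, h2, -⟩ := (P.mem_multipliers_iff hQ₀ hQ hx).1 hy
  have h3 : ‖y.fst‖ ≤ (‖G₀‖ + ∑ i, L i * ‖G i‖) / δ := by
    rw [le_div_iff₀ hδ0, mul_comm]
    refine (hδ y.fst _ h2).trans ?_
    have h4 : toEuclideanLin P.Aᵀ y.fst + -P.couplingGradient x y =
        -(G₀ + ∑ i, y.snd i • G i) := by
      change toEuclideanLin P.Aᵀ y.fst + -(G₀ + toEuclideanLin P.Aᵀ y.fst +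
        ∑ i, y.snd i • G i) = _
      abel
    rw [h4, norm_neg]
    refine (norm_add_le _ _).trans (add_le_add_right ((norm_sum_le _ _).trans
      (Finset.sum_le_sum fun i _ => ?_)) _)
    rw [norm_smul, Real.norm_of_nonneg (h1 i)]
    exact mul_le_mul_of_nonneg_right (hL y hy i) (norm_nonneg _)
  have h5 : ‖y.snd‖ ≤ ∑ i, L i := (EuclideanSpace.norm_le_sum_abs _).trans
    (Finset.sum_le_sum fun i _ => by rw [abs_of_nonneg (h1 i)]; exact hL y hy i)
  exact (WithLp.norm_le_norm_fst_add_norm_snd y).trans (add_le_add h3 h5)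

end

end QCQP

/-! ### Stability of multipliers and limits of displacements -/

namespace QCQP

open Filter Topology

variable {n p m : ℕ} (P : QCQP n p m)

theorem continuous_toEuclideanLin {k l : ℕ} (B : Matrix (Fin k) (Fin l) ℝ) :
    Continuous fun x => toEuclideanLin B x :=
  LinearMap.continuous_of_finiteDimensional _

theorem continuous_g (i : Fin m) : Continuous fun x => P.g x i := by
  have := continuous_toEuclideanLin (P.Q i)
  change Continuous fun x =>
    1 / 2 * inner ℝ x (toEuclideanLin (P.Q i) x) + inner ℝ (P.q i) x + P.r i
  fun_prop

theorem continuous_multiplier (i : Fin m) : Continuous fun y : DualSpace p m => y.snd i :=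
  (EuclideanSpace.proj (𝕜 := ℝ) i).continuous.comp (WithLp.continuous_snd ..)

theorem continuous_couplingGradient :
    Continuous fun z : EuclideanSpace ℝ (Fin n) × DualSpace p m =>
      P.couplingGradient z.1 z.2 := by
  have h1 := continuous_toEuclideanLin P.Q₀
  have h2 := (continuous_toEuclideanLin P.Aᵀ).comp
    (WithLp.continuous_fst 2 (EuclideanSpace ℝ (Fin p)) (EuclideanSpace ℝ (Fin m)))
  have h3 := fun i => continuous_toEuclideanLin (P.Q i)
  have h4 := fun i => continuous_multiplier (p := p) (m := m) i
  refine ((h1.comp continuous_fst).add continuous_const).add (h2.comp continuous_snd) |>.add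
    (continuous_finsetSum _ fun i _ => ((h4 i).comp continuous_snd).smul
      (((h3 i).comp continuous_fst).add continuous_const))

theorem continuous_lagrangianHessian_apply :
    Continuous fun z : EuclideanSpace ℝ (Fin n) × DualSpace p m =>
      toEuclideanLin (P.lagrangianHessian z.2.snd) z.1 := by
  simp only [toEuclideanLin_lagrangianHessian]
  exact ((continuous_toEuclideanLin P.Q₀).comp continuous_fst).add
    (continuous_finsetSum _ fun i _ => ((continuous_multiplier i).comp continuous_snd).smul
      ((continuous_toEuclideanLin (P.Q i)).comp continuous_fst))

theorem couplingGradient_sub (x x' : EuclideanSpace ℝ (Fin n)) (y : DualSpace p m) :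
    P.couplingGradient x' y - P.couplingGradient x y =
      toEuclideanLin (P.lagrangianHessian y.snd) (x' - x) := by
  simp only [couplingGradient, toEuclideanLin_lagrangianHessian, map_sub, smul_add,
    Finset.sum_add_distrib]
  abel

theorem exists_lagrangianHessian_bound (R : ℝ) :
    ∃ K : ℝ, 0 ≤ K ∧ ∀ y : DualSpace p m, ‖y‖ ≤ R → ∀ h,
      ‖toEuclideanLin (P.lagrangianHessian y.snd) h‖ ≤ K * ‖h‖ := by
  obtain ⟨K, hK⟩ := ((isCompact_sphere (0 : EuclideanSpace ℝ (Fin n)) 1).prod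
    (isCompact_closedBall (0 : DualSpace p m) R)).exists_bound_of_continuousOn
      P.continuous_lagrangianHessian_apply.continuousOn
  refine ⟨max K 0, le_max_right _ _, fun y hy h => ?_⟩
  rcases eq_or_ne h 0 with rfl | hh
  · simp
  have hh' : 0 < ‖h‖ := norm_pos_iff.2 hh
  have := hK (‖h‖⁻¹ • h, y) ⟨by simp [norm_smul, hh], by simpa using hy⟩
  simp only [map_smul, norm_smul, norm_inv, norm_norm] at this
  rw [inv_mul_eq_div, div_le_iff₀ hh'] at this
  exact this.trans (mul_le_mul_of_nonneg_right (le_max_left _ _) hh'.le)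

theorem abs_snd_snd_le_norm (w : PDSpace n p m) (i : Fin m) : |w.snd.snd i| ≤ ‖w‖ :=
  (PiLp.norm_apply_le w.snd.snd i).trans
    ((WithLp.norm_snd_le _ w.snd).trans (WithLp.norm_snd_le _ w))

variable {k : ℕ} {a : Fin k → EuclideanSpace ℝ (Fin n)} {c : Fin k → ℝ}
  {x : EuclideanSpace ℝ (Fin n)}

/-- Near a feasible point with multipliers, the dual part of an approximate solution of the KKT
system is close to the multiplier set, with a Lipschitz estimate. -/
theorem exists_multiplier_near (hQ₀ : P.Q₀.PosSemidef) (hQ : ∀ i, (P.Q i).PosSemidef)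
    (hX : P.X = {x | ∀ i, inner ℝ (a i) x ≤ c i}) (hx : x ∈ P.feasible)
    (hne : (P.multipliers x).Nonempty) (R : ℝ) :
    ∃ C : ℝ, 0 ≤ C ∧ ∃ δ > (0 : ℝ), ∀ z ∈ P.domain, ∀ w ∈ P.kktMap z, ‖z.fst - x‖ < δ →
      ‖w‖ < δ → ‖z.snd‖ ≤ R →
        ∃ y ∈ P.multipliers x, ‖z.snd - y‖ ≤ C * (‖w‖ + ‖z.fst - x‖) := by
  have hxX : ∀ i, inner ℝ (a i) x ≤ c i := by have := hx.1; rw [hX] at this; exact this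
  have hconv : Convex ℝ P.X := hX ▸ convex_polyhedron a c
  have hG : ∀ (y : DualSpace p m) (ξ : Fin k → ℝ),
      ∑ i, (Sum.elim ξ (Sum.elim y.fst y.snd) : _ → ℝ) i • P.constraintNormal a x i =
        ∑ j, ξ j • a j + (P.couplingGradient x y - (toEuclideanLin P.Q₀ x + P.q₀)) := by
    intro y ξ
    rw [sum_smul_constraintNormal, couplingGradient]
    simp only [Sum.elim_inl, Sum.elim_inr]
    abel
  obtain ⟨C, hC0, hC⟩ := exists_hoffman_bound_conic_system (P.constraintNormal a x)
    (signConstrained k p m) (P.inactive a c x) (by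
      rintro i hi r rfl
      exact hi) (-(toEuclideanLin P.Q₀ x + P.q₀)) (by
      obtain ⟨y, hy⟩ := hne
      obtain ⟨h1, h2, h3⟩ := (P.mem_multipliers_iff hQ₀ hQ hx).1 hy
      rw [hX] at h2
      obtain ⟨μ, h4, h5, h6⟩ := exists_conic_combination_of_mem_normalConeAt hxX h2
      refine ⟨Sum.elim μ (Sum.elim y.fst y.snd), ?_, ?_, ?_⟩
      · rintro (j | r | i) hi
        exacts [h4 j, absurd rfl (hi r), h1 i]
      · rintro (j | r | i) hi
        exacts [h5 j hi, hi.elim, (mul_eq_zero.1 (h3 i)).resolve_right hi]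
      · rw [hG, ← h6]
        abel)
  obtain ⟨K, hK0, hK⟩ := P.exists_lagrangianHessian_bound R
  -- Constraints inactive at `x` remain inactive nearby, even when `g` is shifted by a small `q.2`,
  -- which will be `‖w‖`.
  have hev : ∀ᶠ q : EuclideanSpace ℝ (Fin n) × ℝ in 𝓝 (x, 0),
      (∀ j, inner ℝ (a j) x ≠ c j → inner ℝ (a j) q.1 < c j) ∧
        ∀ i, P.g x i ≠ 0 → P.g q.1 i + q.2 < 0 := by
    rw [eventually_and, eventually_all, eventually_all]
    refine ⟨fun j => ?_, fun i => ?_⟩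
    · by_cases h : inner ℝ (a j) x = c j
      · simp [h]
      · have hc : Continuous fun q : EuclideanSpace ℝ (Fin n) × ℝ => inner ℝ (a j) q.1 := by
          fun_prop
        exact (hc.continuousAt.eventually_lt continuousAt_const
          (lt_of_le_of_ne (hxX j) h)).mono fun q hq _ => hq
    · by_cases h : P.g x i = 0
      · simp [h]
      · have hc : Continuous fun q : EuclideanSpace ℝ (Fin n) × ℝ => P.g q.1 i + q.2 :=
          ((P.continuous_g i).comp continuous_fst).add continuous_snd
        exact (hc.continuousAt.eventually_lt (continuousAt_const (y := (0 : ℝ)))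
          (by simpa using lt_of_le_of_ne (hx.2.2 i) h)).mono fun q hq _ => hq
  obtain ⟨δ, hδ0, hδ⟩ := Metric.eventually_nhds_iff.1 hev
  -- There are `p + m` dual coordinates; Hoffman's constant `C` multiplies a residual of size at
  -- most `‖w‖ + K * ‖z.fst - x‖`.
  refine ⟨(p + m) * (C * (1 + K)), by positivity, δ, hδ0, fun z hz w hw hzx hwδ hzR => ?_⟩
  obtain ⟨h1, h2, h3, h4⟩ := P.kkt_conditions_of_mem_kktMap hQ₀ hQ hconv hz hw
  obtain ⟨h5, h6⟩ := hδ (y := (z.fst, ‖w‖)) (by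
    rw [Prod.dist_eq, max_lt_iff, dist_eq_norm, dist_zero_right, norm_norm]
    exact ⟨hzx, hwδ⟩)
  have hzX : ∀ i, inner ℝ (a i) z.fst ≤ c i := by have := hz.1; rw [hX] at this; exact this
  rw [hX] at h1
  obtain ⟨μ, h7, h8, h9⟩ := exists_conic_combination_of_mem_normalConeAt hzX h1
  obtain ⟨ξ, e1, e2, e3, e4⟩ := hC (Sum.elim μ (Sum.elim z.snd.fst z.snd.snd)) (by
      rintro (j | r | i) hi
      exacts [h7 j, absurd rfl (hi r), hz.2 i]) (by
      rintro (j | r | i) hi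
      · exact h8 j (h5 j hi).ne
      · exact hi.elim
      · refine (mul_eq_zero.1 (h4 i)).resolve_right (ne_of_lt ?_)
        have := (le_abs_self _).trans (abs_snd_snd_le_norm w i)
        linarith [h6 i hi])
  refine ⟨_, P.mem_multipliers_of_combination hQ₀ hQ hX hx e1 e2 e3, ?_⟩
  have e5 : ∀ i, |(Sum.elim μ (Sum.elim z.snd.fst z.snd.snd) : _ → ℝ) i - ξ i| ≤
      C * (1 + K) * (‖w‖ + ‖z.fst - x‖) := by
    intro i
    refine (e4 i).trans ?_
    rw [hG, ← h9, mul_assoc]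
    refine mul_le_mul_of_nonneg_left ?_ hC0
    have e6 : w.fst - P.couplingGradient z.fst z.snd + (P.couplingGradient x z.snd -
        (toEuclideanLin P.Q₀ x + P.q₀)) - -(toEuclideanLin P.Q₀ x + P.q₀) =
          w.fst - toEuclideanLin (P.lagrangianHessian z.snd.snd) (z.fst - x) := by
      rw [← couplingGradient_sub]
      abel
    rw [e6]
    have e7 := norm_sub_le w.fst (toEuclideanLin (P.lagrangianHessian z.snd.snd) (z.fst - x))
    have e8 := hK z.snd hzR (z.fst - x)
    have e9 := WithLp.norm_fst_le _ w
    have := mul_nonneg hK0 (norm_nonneg w)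
    have := norm_nonneg (z.fst - x)
    linarith
  refine (WithLp.norm_le_norm_fst_add_norm_snd _).trans ((add_le_add
    ((EuclideanSpace.norm_le_sum_abs _).trans (Finset.sum_le_sum fun r _ =>
      e5 (Sum.inr (Sum.inl r))))
    ((EuclideanSpace.norm_le_sum_abs _).trans (Finset.sum_le_sum fun i _ =>
      e5 (Sum.inr (Sum.inr i))))).trans_eq ?_)
  simp
  ring

/-- Limits of normalized primal displacements of asymptotically exact KKT points are critical
directions. -/
theorem mem_criticalCone_of_tendsto (hQ₀ : P.Q₀.PosSemidef) (hQ : ∀ i, (P.Q i).PosSemidef)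
    (hX : P.X = {x | ∀ i, inner ℝ (a i) x ≤ c i}) (hx : x ∈ P.feasible)
    {z w : ℕ → PDSpace n p m} (hz : ∀ j, z j ∈ P.domain) (hw : ∀ j, w j ∈ P.kktMap (z j))
    {t r : ℕ → ℝ} {d : ℕ → EuclideanSpace ℝ (Fin n)} (ht0 : ∀ j, 0 < t j)
    (hd : ∀ j, (z j).fst - x = t j • d j) (hwr : ∀ j, ‖w j‖ ≤ t j * r j)
    (ht : Tendsto t atTop (𝓝 0)) (hr : Tendsto r atTop (𝓝 0))
    {e : EuclideanSpace ℝ (Fin n)} (hde : Tendsto d atTop (𝓝 e))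
    {y : DualSpace p m} (hzy : Tendsto (fun j => (z j).snd) atTop (𝓝 y))
    (hy : y ∈ P.multipliers x) : e ∈ P.criticalCone x := by
  have hxX : ∀ i, inner ℝ (a i) x ≤ c i := by have := hx.1; rw [hX] at this; exact this
  have hconv : Convex ℝ P.X := hX ▸ convex_polyhedron a c
  obtain ⟨hy1, hy2, hy3⟩ := (P.mem_multipliers_iff hQ₀ hQ hx).1 hy
  have hkkt := fun j => P.kkt_conditions_of_mem_kktMap hQ₀ hQ hconv (hz j) (hw j)
  have hzx : ∀ j, (z j).fst = x + t j • d j := fun j => by rw [← hd, add_sub_cancel]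
  have hinner : ∀ u, Tendsto (fun j => inner ℝ u (d j)) atTop (𝓝 (inner ℝ u e)) := fun u =>
    tendsto_const_nhds.inner hde
  have hzx' : Tendsto (fun j => (z j).fst) atTop (𝓝 x) := by
    simp only [hzx]
    simpa using (tendsto_const_nhds (x := x)).add (ht.smul hde)
  have hea : ∀ i, inner ℝ (a i) x = c i → inner ℝ (a i) e ≤ 0 := fun i hi => by
    refine le_of_tendsto (hinner _) (.of_forall fun j => ?_)
    have := (hz j).1
    rw [hX, hzx j] at this
    have := this i
    rw [inner_add_right, real_inner_smul_right, hi] at this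
    exact nonpos_of_mul_nonpos_right (by linarith) (ht0 j)
  have heA : toEuclideanLin P.A e = 0 := by
    refine tendsto_nhds_unique (((continuous_toEuclideanLin P.A).tendsto e).comp hde)
      (squeeze_zero_norm (fun j => ?_) hr)
    have h1 := (hkkt j).2.1
    rw [hzx j, map_add, hx.2.1, add_sub_cancel_left, map_smul] at h1
    have h2 : ‖(w j).snd.fst‖ ≤ t j * r j :=
      ((WithLp.norm_fst_le _ (w j).snd).trans (WithLp.norm_snd_le _ (w j))).trans (hwr j)
    rw [← norm_neg, ← h1, norm_smul, Real.norm_of_nonneg (ht0 j).le] at h2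
    exact le_of_mul_le_mul_left h2 (ht0 j)
  -- The constraint perturbation at the scale of the displacement; it tends to zero since `‖w j‖ =
  -- o(t j)`.
  set s : Fin m → ℕ → ℝ := fun i j => (t j)⁻¹ * (w j).snd.snd i with hs
  have hsr : ∀ i j, |s i j| ≤ r j := fun i j => by
    have h1 := (abs_snd_snd_le_norm (w j) i).trans (hwr j)
    rw [hs, abs_mul, abs_of_pos (inv_pos.2 (ht0 j)), inv_mul_le_iff₀ (ht0 j)]
    exact h1
  have hs0 : ∀ i, Tendsto (s i) atTop (𝓝 0) := fun i =>
    squeeze_zero_norm (fun j => hsr i j) hr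
  have hgs : ∀ i j, P.g x i = 0 → P.g (z j).fst i + (w j).snd.snd i =
      t j * (inner ℝ (toEuclideanLin (P.Q i) x + P.q i) (d j) +
        t j * (1 / 2 * inner ℝ (d j) (toEuclideanLin (P.Q i) (d j))) + s i j) := by
    intro i j hi
    rw [hzx j, P.g_add hQ, hi, map_smul, real_inner_smul_left, real_inner_smul_right,
      real_inner_smul_right, mul_add, mul_add, hs]
    dsimp only
    rw [mul_inv_cancel_left₀ (ht0 j).ne']
    ring
  have hlim : ∀ i, Tendsto (fun j => inner ℝ (toEuclideanLin (P.Q i) x + P.q i) (d j) +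
      t j * (1 / 2 * inner ℝ (d j) (toEuclideanLin (P.Q i) (d j))) + s i j) atTop
        (𝓝 (inner ℝ (toEuclideanLin (P.Q i) x + P.q i) e)) := by
    intro i
    have h1 : Tendsto (fun j => 1 / 2 * inner ℝ (d j) (toEuclideanLin (P.Q i) (d j))) atTop
        (𝓝 (1 / 2 * inner ℝ e (toEuclideanLin (P.Q i) e))) :=
      (hde.inner (((continuous_toEuclideanLin (P.Q i)).tendsto e).comp hde)).const_mul _
    simpa using ((hinner _).add (ht.mul h1)).add (hs0 i)
  have heg : ∀ i, P.g x i = 0 → inner ℝ (toEuclideanLin (P.Q i) x + P.q i) e ≤ 0 :=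
    fun i hi => le_of_tendsto (hlim i) (.of_forall fun j => by
      have := (hkkt j).2.2.1 i
      rw [hgs i j hi] at this
      exact nonpos_of_mul_nonpos_right this (ht0 j))
  have hcomp : ∀ i, y.snd i * inner ℝ (toEuclideanLin (P.Q i) x + P.q i) e = 0 := by
    intro i
    by_cases hi : P.g x i = 0
    · refine tendsto_nhds_unique ((((continuous_multiplier i).tendsto y).comp hzy).mul (hlim i))
        (tendsto_const_nhds.congr fun j => ?_)
      have := (hkkt j).2.2.2 i
      rw [hgs i j hi, mul_left_comm] at this
      exact ((mul_eq_zero.1 this).resolve_left (ht0 j).ne').symm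
    · rw [(mul_eq_zero.1 (hy3 i)).resolve_right hi, zero_mul]
  -- One inequality is the limit of the normal cone condition at `z j` tested against `x`; the other
  -- is stationarity of `y` at `x` tested against the tangent direction `e`. With `heA` and `hcomp`,
  -- only the objective gradient survives in this product.
  have hgrad : inner ℝ (P.couplingGradient x y) e = 0 := by
    refine le_antisymm ?_ ?_
    · have h1 : Tendsto (fun j => inner ℝ ((w j).fst - P.couplingGradient (z j).fst (z j).snd)
          (d j)) atTop (𝓝 (inner ℝ (0 - P.couplingGradient x y) e)) := by
        refine Tendsto.inner (Tendsto.sub (squeeze_zero_norm (fun j =>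
          (WithLp.norm_fst_le _ (w j)).trans (hwr j)) (by simpa using ht.mul hr)) ?_) hde
        exact (P.continuous_couplingGradient.tendsto (x, y)).comp (hzx'.prodMk_nhds hzy)
      rw [zero_sub, inner_neg_left] at h1
      refine neg_nonneg.1 (ge_of_tendsto h1 (.of_forall fun j => ?_))
      have h2 := (hkkt j).1 x hx.1
      rw [← neg_sub (z j).fst x, hd j, inner_neg_right, real_inner_smul_right, neg_nonpos] at h2
      exact nonneg_of_mul_nonneg_right h2 (ht0 j)
    · rw [hX] at hy2
      have := inner_nonpos_of_mem_normalConeAt_polyhedron hxX hy2 hea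
      rwa [inner_neg_left, neg_nonpos] at this
  refine ⟨?_, heA, ?_, heg⟩
  · rw [hX, mem_bouligandCone_polyhedron_iff hxX]
    exact hea
  · rw [couplingGradient, inner_add_left, inner_add_left, inner_toEuclideanLin_transpose, heA,
      inner_zero_right, add_zero, sum_inner] at hgrad
    simpa only [real_inner_smul_left, hcomp, Finset.sum_const_zero, add_zero] using hgrad

end QCQP

/-- This turns vanishing curvature into a kernel condition, from which the dual-cone condition of
the second-order hypothesis follows. -/
theorem Matrix.PosSemidef.toEuclideanLin_eq_zero {n : ℕ} {B : Matrix (Fin n) (Fin n) ℝ}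
    (hB : B.PosSemidef) {d : EuclideanSpace ℝ (Fin n)}
    (hd : inner ℝ d (toEuclideanLin B d) = 0) : toEuclideanLin B d = 0 := by
  have h := (hB.dotProduct_mulVec_zero_iff d.ofLp).1 (by
    rw [← hd, PiLp.inner_apply]
    simp [dotProduct, mul_comm])
  rw [toLpLin_apply, h]
  rfl

/-! ### Primal and primal-dual error bounds -/

namespace QCQP

open Filter Topology

variable {n p m : ℕ} (P : QCQP n p m) {k : ℕ} {a : Fin k → EuclideanSpace ℝ (Fin n)}
  {c : Fin k → ℝ} {x : EuclideanSpace ℝ (Fin n)}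

/-- Under the second-order condition, the primal error is bounded by the KKT residual. -/
theorem exists_primal_error_bound (hQ₀ : P.Q₀.PosSemidef) (hQ : ∀ i, (P.Q i).PosSemidef)
    (hX : P.X = {x | ∀ i, inner ℝ (a i) x ≤ c i}) (hx : x ∈ P.feasible)
    (hne : (P.multipliers x).Nonempty) (hbdd : Bornology.IsBounded (P.multipliers x))
    (hcl : IsClosed (P.multipliers x))
    (hcrit : ∀ y ∈ P.multipliers x, ∀ d ∈ P.criticalCone x,
      toEuclideanLin (P.lagrangianHessian y.snd) d = 0 → d = 0) :
    ∃ C : ℝ, 0 ≤ C ∧ ∃ ε > (0 : ℝ), ∀ z ∈ P.domain, ∀ w ∈ P.kktMap z,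
      ‖z.fst - x‖ + Metric.infDist z.snd (P.multipliers x) ≤ ε → ‖z.fst - x‖ ≤ C * ‖w‖ := by
  have hconv : Convex ℝ P.X := hX ▸ convex_polyhedron a c
  by_contra! hcon
  have hseq : ∀ j : ℕ, ∃ z ∈ P.domain, ∃ w ∈ P.kktMap z,
      ‖z.fst - x‖ + Metric.infDist z.snd (P.multipliers x) ≤ 1 / ((j : ℝ) + 1) ∧
        ((j : ℝ) + 1) * ‖w‖ < ‖z.fst - x‖ := fun j =>
    hcon (j + 1) (by positivity) (1 / (j + 1)) (by positivity)
  choose z hz w hw hε hC using hseq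
  obtain ⟨M, hM⟩ := isBounded_iff_forall_norm_le.1 hbdd
  have hone : ∀ j : ℕ, 1 / ((j : ℝ) + 1) ≤ 1 := fun j => by
    rw [div_le_one (by positivity)]
    linarith [(Nat.cast_nonneg j : (0 : ℝ) ≤ j)]
  -- The distance to the multipliers is at most `1`; the radius `2` leaves room for the strict
  -- inequality that yields a nearby multiplier.
  have hR : ∀ j, ‖(z j).snd‖ ≤ M + 2 := fun j => by
    obtain ⟨y, hy, hd⟩ := (Metric.infDist_lt_iff (r := 2) hne).1
      (show Metric.infDist (z j).snd (P.multipliers x) < 2 by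
        linarith [hε j, hone j, norm_nonneg ((z j).fst - x)])
    rw [dist_eq_norm] at hd
    have := norm_le_norm_add_norm_sub' (z j).snd y
    linarith [hM y hy]
  set t : ℕ → ℝ := fun j => ‖(z j).fst - x‖ with ht
  have ht0 : ∀ j, 0 < t j := fun j => lt_of_le_of_lt (by positivity) (hC j)
  set d : ℕ → EuclideanSpace ℝ (Fin n) := fun j => (t j)⁻¹ • ((z j).fst - x) with hd
  have hd1 : ∀ j, ‖d j‖ = 1 := fun j => by
    rw [hd]
    dsimp only
    rw [norm_smul, norm_inv, Real.norm_of_nonneg (ht0 j).le]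
    exact inv_mul_cancel₀ (ht0 j).ne'
  obtain ⟨⟨e, y⟩, ⟨he, -⟩, φ, hφ, hlim⟩ :=
    ((isCompact_sphere (0 : EuclideanSpace ℝ (Fin n)) 1).prod
      (isCompact_closedBall (0 : DualSpace p m) (M + 2))).tendsto_subseq
        (x := fun j => (d j, (z j).snd)) (fun j => ⟨by simpa using hd1 j, by simpa using hR j⟩)
  have hde : Tendsto (fun j => d (φ j)) atTop (𝓝 e) := hlim.fst_nhds
  have hzy : Tendsto (fun j => (z (φ j)).snd) atTop (𝓝 y) := hlim.snd_nhds
  have hr : Tendsto (fun j => 1 / ((φ j : ℝ) + 1)) atTop (𝓝 0) :=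
    (tendsto_one_div_add_atTop_nhds_zero_nat (𝕜 := ℝ)).comp hφ.tendsto_atTop
  have hinf : ∀ j, 0 ≤ Metric.infDist (z j).snd (P.multipliers x) := fun j =>
    Metric.infDist_nonneg
  have htt : Tendsto (fun j => t (φ j)) atTop (𝓝 0) :=
    squeeze_zero (fun j => (ht0 _).le) (fun j => by linarith [hε (φ j), hinf (φ j)]) hr
  have hy : y ∈ P.multipliers x := by
    rw [hcl.mem_iff_infDist_zero hne]
    refine tendsto_nhds_unique (((Metric.continuous_infDist_pt _).tendsto y).comp hzy)
      (squeeze_zero (fun j => hinf _) (fun j => ?_) hr)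
    exact (le_add_of_nonneg_left (norm_nonneg _)).trans (hε (φ j))
  have hzd : ∀ j, (z j).fst - x = t j • d j := fun j => by
    rw [hd]
    dsimp only
    rw [smul_smul, mul_inv_cancel₀ (ht0 j).ne', one_smul]
  have hwr : ∀ j, ‖w j‖ ≤ t j * (1 / ((j : ℝ) + 1)) := fun j => by
    rw [mul_one_div, le_div_iff₀ (by positivity), mul_comm]
    exact (hC j).le
  have hec : e ∈ P.criticalCone x :=
    P.mem_criticalCone_of_tendsto hQ₀ hQ hX hx (fun j => hz (φ j)) (fun j => hw (φ j))
      (fun j => ht0 (φ j)) (fun j => hzd (φ j)) (fun j => hwr (φ j)) htt hr hde hzy hy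
  obtain ⟨C, hC0, δ, hδ0, hnear⟩ := P.exists_multiplier_near hQ₀ hQ hX hx hne (M + 2)
  have hpsd := P.posSemidef_lagrangianHessian hQ₀ hQ hy.1
  have hcurv : 1 / 2 * inner ℝ e (toEuclideanLin (P.lagrangianHessian y.snd) e) ≤ 0 := by
    have h1 : Tendsto (fun j => 1 / 2 * inner ℝ (d (φ j))
        (toEuclideanLin (P.lagrangianHessian (z (φ j)).snd.snd) (d (φ j)))) atTop
        (𝓝 (1 / 2 * inner ℝ e (toEuclideanLin (P.lagrangianHessian y.snd) e))) :=
      (hde.inner ((P.continuous_lagrangianHessian_apply.tendsto (e, y)).comp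
        (hde.prodMk_nhds hzy))).const_mul _
    -- As `‖w‖ ≤ t`, the nearest-multiplier estimate gives dual error at most `2 * C * t`, so the
    -- curvature bound divided by `t²` is at most this sequence.
    have h2 : Tendsto (fun j => 1 / ((φ j : ℝ) + 1) * (1 + 2 * C)) atTop (𝓝 0) := by
      simpa using hr.mul_const (1 + 2 * C)
    refine le_of_tendsto_of_tendsto h1 h2 ?_
    filter_upwards [htt.eventually (Iio_mem_nhds hδ0)] with j hj
    have hwt : ‖w (φ j)‖ ≤ t (φ j) := (hwr _).trans
      (mul_le_of_le_one_right (ht0 _).le (hone _))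
    obtain ⟨y', hy', hyz⟩ := hnear _ (hz (φ j)) _ (hw (φ j)) hj (hwt.trans_lt hj) (hR _)
    have h3 := P.curvature_le_of_mem_kktMap hQ₀ hQ hconv hx hy' (hz (φ j)) (hw (φ j))
    have h4 : ‖(z (φ j)).snd - y'‖ ≤ C * (t (φ j) + t (φ j)) :=
      hyz.trans (mul_le_mul_of_nonneg_left (add_le_add hwt le_rfl) hC0)
    have h5 : ‖w (φ j)‖ * (‖(z (φ j)).fst - x‖ + ‖(z (φ j)).snd - y'‖) ≤
        t (φ j) * (1 / ((φ j : ℝ) + 1)) * (t (φ j) + C * (t (φ j) + t (φ j))) :=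
      mul_le_mul (hwr _) (add_le_add le_rfl h4) (by positivity)
        (mul_nonneg (ht0 _).le (by positivity))
    have h6 := h3.trans h5
    rw [hzd, map_smul, real_inner_smul_left, real_inner_smul_right] at h6
    refine le_of_mul_le_mul_left ?_ (mul_pos (ht0 (φ j)) (ht0 (φ j)))
    linarith
  have hzero : inner ℝ e (toEuclideanLin (P.lagrangianHessian y.snd) e) = 0 :=
    le_antisymm (by linarith) (hpsd.inner_toEuclideanLin_nonneg e)
  have := hcrit y hy e hec (hpsd.toEuclideanLin_eq_zero hzero)
  simp [this] at he

/-- Local error bound for the KKT system. -/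
theorem exists_kkt_error_bound (hQ₀ : P.Q₀.PosSemidef) (hQ : ∀ i, (P.Q i).PosSemidef)
    (hX : P.X = {x | ∀ i, inner ℝ (a i) x ≤ c i}) (hx : x ∈ P.feasible)
    (hne : (P.multipliers x).Nonempty) (hbdd : Bornology.IsBounded (P.multipliers x))
    (hcl : IsClosed (P.multipliers x))
    (hcrit : ∀ y ∈ P.multipliers x, ∀ d ∈ P.criticalCone x,
      toEuclideanLin (P.lagrangianHessian y.snd) d = 0 → d = 0) :
    ∃ C > (0 : ℝ), ∃ ε > (0 : ℝ), ∀ z ∈ P.domain, ∀ w ∈ P.kktMap z,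
      ‖z.fst - x‖ + Metric.infDist z.snd (P.multipliers x) ≤ ε →
        ‖z.fst - x‖ + Metric.infDist z.snd (P.multipliers x) ≤ C * ‖w‖ := by
  obtain ⟨C₁, hC₁, ε₁, hε₁, h₁⟩ := P.exists_primal_error_bound hQ₀ hQ hX hx hne hbdd hcl hcrit
  obtain ⟨M, hM⟩ := isBounded_iff_forall_norm_le.1 hbdd
  obtain ⟨C₂, hC₂, δ, hδ, h₂⟩ := P.exists_multiplier_near hQ₀ hQ hX hx hne (M + 2)
  -- The first two terms serve residuals below `δ`. For larger ones `1 / δ` suffices, because the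
  -- left side is at most `1`.
  refine ⟨C₁ + C₂ * (1 + C₁) + 1 / δ, by positivity, min ε₁ (min 1 (δ / 2)), by positivity,
    fun z hz w hw hzε => ?_⟩
  have e1 := hzε.trans (min_le_left _ _)
  have e2 := (hzε.trans (min_le_right _ _)).trans (min_le_left _ _)
  have e3 := (hzε.trans (min_le_right _ _)).trans (min_le_right _ _)
  have hw0 := norm_nonneg w
  have hinf : 0 ≤ Metric.infDist z.snd (P.multipliers x) := Metric.infDist_nonneg
  rcases lt_or_ge ‖w‖ δ with hwδ | hwδ
  · have h3 := h₁ z hz w hw e1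
    have hzR : ‖z.snd‖ ≤ M + 2 := by
      obtain ⟨y, hy, hd⟩ := (Metric.infDist_lt_iff (r := 2) hne).1
        (show Metric.infDist z.snd (P.multipliers x) < 2 by
          linarith [norm_nonneg (z.fst - x)])
      rw [dist_eq_norm] at hd
      have := norm_le_norm_add_norm_sub' z.snd y
      linarith [hM y hy]
    obtain ⟨y, hy, hyz⟩ := h₂ z hz w hw (by linarith) hwδ hzR
    have h4 := Metric.infDist_le_dist_of_mem (x := z.snd) hy
    rw [dist_eq_norm] at h4
    have h5 := mul_le_mul_of_nonneg_left (add_le_add_right h3 ‖w‖) hC₂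
    have h6 : 0 ≤ 1 / δ * ‖w‖ := by positivity
    calc _ ≤ C₁ * ‖w‖ + C₂ * (‖w‖ + C₁ * ‖w‖) := add_le_add h3 (h4.trans (hyz.trans h5))
      _ ≤ C₁ * ‖w‖ + C₂ * (‖w‖ + C₁ * ‖w‖) + 1 / δ * ‖w‖ := le_add_of_nonneg_right h6
      _ = _ := by ring
  · have h3 : 1 ≤ 1 / δ * ‖w‖ := by
      rw [one_div_mul_eq_div, le_div_iff₀ hδ]
      linarith
    have h4 : 0 ≤ (C₁ + C₂ * (1 + C₁)) * ‖w‖ := by positivity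
    rw [add_mul]
    exact e2.trans (h3.trans (le_add_of_nonneg_left h4))

theorem isClosed_multipliers (hQ₀ : P.Q₀.PosSemidef) (hQ : ∀ i, (P.Q i).PosSemidef)
    (hx : x ∈ P.feasible) : IsClosed (P.multipliers x) := by
  have h : P.multipliers x = {y | ∀ i, 0 ≤ y.snd i} ∩
      ((fun y => -P.couplingGradient x y) ⁻¹' normalConeAt P.X x ∩
        {y | ∀ i, y.snd i * P.g x i = 0}) :=
    Set.ext fun y => P.mem_multipliers_iff hQ₀ hQ hx
  have hc := fun i => continuous_multiplier (p := p) (m := m) i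
  have hpair : Continuous fun y : DualSpace p m => (x, y) := by fun_prop
  have hg := P.continuous_couplingGradient.comp hpair
  rw [h]
  simp only [Set.ofPred_forall]
  exact (isClosed_iInter fun i => isClosed_le continuous_const (hc i)).inter
    (((isClosed_normalConeAt _ _).preimage hg.neg).inter
      (isClosed_iInter fun i => isClosed_eq ((hc i).mul continuous_const) continuous_const))

/-- The product of `{x}` with the multiplier set lies in the saddle set. -/
theorem infDist_saddleSet_le (hQ₀ : P.Q₀.PosSemidef) (hQ : ∀ i, (P.Q i).PosSemidef)
    (hx : x ∈ P.feasible) (hne : (P.multipliers x).Nonempty) (z : PDSpace n p m) :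
    Metric.infDist z P.saddleSet ≤
      ‖z.fst - x‖ + Metric.infDist z.snd (P.multipliers x) := by
  rw [← sub_le_iff_le_add', Metric.le_infDist hne]
  intro y hy
  have h1 := Metric.infDist_le_dist_of_mem (x := z)
    (P.mem_saddleSet_of_mem_multipliers hQ₀ hQ hx hy)
  rw [dist_eq_norm] at h1 ⊢
  have h2 := WithLp.norm_le_norm_fst_add_norm_snd (z - WithLp.toLp 2 (x, y))
  change _ ≤ ‖z.fst - x‖ + ‖z.snd - y‖ at h2
  linarith

end QCQP

theorem mainTheorem4 {n p m : ℕ} (P : QCQP n p m)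
    (hX : IsPolyhedralSet P.X)
    (hQ₀ : P.Q₀.PosSemidef) (hQ : ∀ i, (P.Q i).PosSemidef)
    (xs : EuclideanSpace ℝ (Fin n)) (hopt : P.IsOptimal xs)
    (hMFCQ : P.MFCQ xs)
    (hcrit : ∀ y ∈ P.multipliers xs, ∀ d ∈ P.criticalCone xs,
      Matrix.toEuclideanLin (P.lagrangianHessian y.snd) d ∈ dualCone (P.criticalCone xs) →
      inner ℝ d (Matrix.toEuclideanLin (P.lagrangianHessian y.snd) d) = 0 → d = 0) :
    (P.multipliers xs).Nonempty ∧ P.saddleSet.Nonempty ∧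
    ∃ c > (0 : ℝ), ∃ ε > (0 : ℝ), ∀ z ∈ P.domain,
      ‖z.fst - xs‖ + Metric.infDist z.snd (P.multipliers xs) ≤ ε →
        (P.kktMap z).Nonempty ∧
        Metric.infDist z P.saddleSet ≤ c * Metric.infDist 0 (P.kktMap z) := by
  obtain ⟨k, a, c, hXa⟩ := hX
  have hx := hopt.1
  have hne := P.multipliers_nonempty hQ₀ hQ hXa hopt hMFCQ
  obtain ⟨C, hC, ε, hε, h⟩ := P.exists_kkt_error_bound hQ₀ hQ hXa hx hne
    (P.isBounded_multipliers hQ₀ hQ hXa hx hMFCQ) (P.isClosed_multipliers hQ₀ hQ hx)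
    -- When `Q(λ) d = 0`, both remaining requirements of the second-order hypothesis hold trivially.
    (fun y hy d hd h0 => hcrit y hy d hd (by rw [h0]; intro x _; simp) (by rw [h0]; simp))
  refine ⟨hne, ?_, C, hC, ε, hε, fun z hz hzε => ?_⟩
  · obtain ⟨y, hy⟩ := hne
    exact ⟨_, P.mem_saddleSet_of_mem_multipliers hQ₀ hQ hx hy⟩
  have hF := P.kktMap_nonempty hQ₀ hQ hz
  refine ⟨hF, ?_⟩
  rw [← div_le_iff₀' hC, Metric.le_infDist hF]
  intro w hw
  rw [dist_zero_left, div_le_iff₀' hC]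
  exact (P.infDist_saddleSet_le hQ₀ hQ hx hne z).trans (h z hz w hw hzε)
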